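/- Let $K$ be a field, $R=K[X]$, $R'=K[X,Y]/(Y(X-Y))$, and let $n\ge 2$. Let $\Lambda$ be the $R$-algebra of all $n\times n$ matrices over $R'[X^{-1}]$ whose $(i,j)$ entry lies in $$\Lambda_{ij}=\begin{cases}X^{-1}(X,Y) & \text{if } (i,j)=(1,n),\\ R' & \text{if } i\le j \text{ and } (i,j)\ne(1,n),\\ (X,Y) & \text{if } i=j+1,\\ (X) & \text{if } i>j+1,\end{cases}$$ where the ideals are those of $R'$, regarded as $R'$-submodules of $R'[X^{-1}]$. A left $\Lambda$-module $M$ is Cohen–Macaulay (CM) if it is finitely generated over $R$ and has zero socle over $R$. Let $P^*$ be the once-punctured polygon with vertices $P_1,\dots,P_n$ numbered counter-clockwise. Let $\mathcal S$ be the set of its sides and tagged arcs (up to isotopy), that is: for each ordered pair $r\neq s$ the class $(P_r,P_s)$ of the curve from $P_r$ to $P_s$ turning counter-clockwise around the puncture (a side if $s\equiv r+1 \bmod n$, an arc otherwise); and for each $r$ the plain arc $(P_r,*)$ and the notched arc $(P_r,\bowtie)$ from $P_r$ to the puncture. For $a\in\mathcal S$ let $M_a$ be the left $\Lambda$-module (under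 matrix multiplication) of column vectors over $R'[X^{-1}]$ whose $n$ successive coordinates lie in the following ideals of $R'$: * $a=(P_r,*)$: $r$ times $(Y)$, then $n-r$ times $(Y^2)$; * $a=(P_r,\bowtie)$: $r$ times $(X-Y)$, then $n-r$ times $(X^2-Y^2)$; * $a=(P_r,P_s)$ with $r<s$: $r$ times $R'$, then $s-r$ times $(X,Y)$, then $n-s$ times $(X)$; * $a=(P_r,P_s)$ with $r>s$: $s$ times $(X,Y)$, then $r-s$ times $(X)$, then $n-r$ times $(X^2,Y^2)$. Then: 1. The map $a\mapsto M_a$ induces a bijection from $\mathcal S$ to the set of isomorphism classes of indecomposable CM $\Lambda$-modules; that is, each $M_a$ is an indecomposable CM $\Lambda$-module, $M_a\cong M_b$ implies $a=b$, and every indecomposable CM $\Lambda$-module is isomorphic to some $M_a$. 2. Every CM $\Lambda$-module is isomorphic to $\bigoplus_{a\in\mathcal S}M_a^{l_a}$ for some non-negative integers $l_a$, and the $l_a$ are uniquely determined. -/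

import Mathlib

open Polynomial

universe u v

/-! ### Orders and Cohen-Macaulay modules -/

/-- The socle of a module: the sum of its simple submodules. -/
def moduleSocle (A M : Type*) [Ring A] [AddCommGroup M] [Module A M] : Submodule A M :=
  sSup {N : Submodule A M | IsSimpleModule A N}

/-- A left module `M` over an `S`-algebra `A` is (maximal) Cohen-Macaulay if it is finitely
generated over `S` and its socle over `S` is zero. -/
def IsCMModule (S A M : Type*) [CommRing S] [Ring A] [Algebra S A] [AddCommGroup M]
    [Module S M] [Module A M] [IsScalarTower S A M] : Prop :=
  Module.Finite S M ∧ moduleSocle S M = ⊥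

/-- A nonzero module is indecomposable if it is not the internal direct sum of two nonzero
submodules. -/
def IsIndecomposableModule (A M : Type*) [Ring A] [AddCommGroup M] [Module A M] : Prop :=
  Nontrivial M ∧ ∀ N N' : Submodule A M, IsCompl N N' → N = ⊥ ∨ N' = ⊥

namespace PuncturedPolygon

/-! ### Sides and tagged arcs -/

/-- The sides and tagged arcs (up to isotopy) of the once-punctured polygon with vertices
`P_1, …, P_n` numbered counter-clockwise; the vertex `P_{i+1}` is represented by `i : Fin n`.

* `seg r s` with `r ≠ s` is the class of the curve from `P_r` to `P_s` that turns
  counter-clockwise around the puncture. It is a side when `P_s` follows `P_r` counter-clockwise,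
  and a tagged arc not incident to the puncture otherwise.
* `plain r` and `notched r` are the two tagged versions of the arc from `P_r` to the puncture. -/
inductive Edge (n : ℕ) : Type
  | seg (r s : Fin n) (hrs : r ≠ s) : Edge n
  | plain (r : Fin n) : Edge n
  | notched (r : Fin n) : Edge n

/-! ### The entries of the order `Λ` and of the modules `M_a`

Here `B` is an algebra over `A` with elements `x`, `y`, `xi`. Below these are used for `A = R'`,
`B = R'[X⁻¹]`, `x = X`, `y = Y`, `xi = X⁻¹`. -/

section Entries

variable (A : Type*) {B : Type*} [CommRing A] [CommRing B] [Algebra A B] (x y xi : B) {n : ℕ}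

/-- The entries of the order `Λ`: the `(1, n)` entry is `X⁻¹(X, Y) = (1, X⁻¹Y)`; the other entries
on or above the diagonal are `R'`; those just below the diagonal are `(X, Y)`; the other ones are
`(X)`. (The code numbers rows and columns from `0`.) -/
def orderEntry (i j : Fin n) : Submodule A B :=
  if (i : ℕ) = 0 ∧ (j : ℕ) + 1 = n then Submodule.span A {1, xi * y}
  else if i ≤ j then Submodule.span A {1}
  else if (i : ℕ) = j + 1 then Submodule.span A {x, y}
  else Submodule.span A {x}

/-- The coordinates of the column modules `M_a`:

* for `a = (P_r, *)`: `r` coordinates `(Y)`, then `n - r` coordinates `(Y²)`;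
* for `a = (P_r, ⋈)`: `r` coordinates `(X - Y)`, then `n - r` coordinates `(X² - Y²)`;
* for `a = (P_r, P_s)`, `r < s`: `r` coordinates `R'`, then `s - r` coordinates `(X, Y)`, then
  `n - s` coordinates `(X)`;
* for `a = (P_r, P_s)`, `s < r`: `s` coordinates `(X, Y)`, then `r - s` coordinates `(X)`, then
  `n - r` coordinates `(X², Y²)`.

(The code numbers vertices and coordinates from `0`.) -/
def columnEntry : Edge n → Fin n → Submodule A B
  | .plain r, i => if i ≤ r then Submodule.span A {y} else Submodule.span A {y ^ 2}
  | .notched r, i =>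
      if i ≤ r then Submodule.span A {x - y} else Submodule.span A {x ^ 2 - y ^ 2}
  | .seg r s _, i =>
      if r < s then
        if i ≤ r then Submodule.span A {1}
        else if i ≤ s then Submodule.span A {x, y}
        else Submodule.span A {x}
      else
        if i ≤ s then Submodule.span A {x, y}
        else if i ≤ r then Submodule.span A {x}
        else Submodule.span A {x ^ 2, y ^ 2}

variable {A x y xi}

theorem mem_span_of_eq {s : Set B} {g w : B} (hg : g ∈ s) (h : g = w) :
    w ∈ Submodule.span A s :=
  h ▸ Submodule.subset_span hg

theorem mul_mem_span {c : B} (hc : c ∈ Set.range (algebraMap A B)) {s : Set B} {g w : B}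
    (hg : g ∈ s) (h : c * g = w) : w ∈ Submodule.span A s := by
  obtain ⟨c, rfl⟩ := hc
  rw [← h, ← Algebra.smul_def]
  exact Submodule.smul_mem _ _ (Submodule.subset_span hg)

theorem mem_of_span {c : B} {t : Set B} {N : Submodule A B} (h : ∀ q ∈ t, c * q ∈ N) {b : B}
    (hb : b ∈ Submodule.span A t) : c * b ∈ N := by
  induction hb using Submodule.span_induction with
  | mem p hp => exact h p hp
  | zero => simp
  | add p q _ _ hp hq => rw [mul_add]; exact add_mem hp hq
  | smul d p _ hp => rw [mul_smul_comm]; exact Submodule.smul_mem _ _ hp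

/-- A family of submodules that is stable under the generators of the entries of `Λ` is stable
under the entries of `Λ`. -/
theorem orderEntry_mul_of_stable {C : Fin n → Submodule A B}
    (h1 : ∀ i j : Fin n, (i : ℕ) ≤ j → ∀ b ∈ C j, 1 * b ∈ C i)
    (hx : ∀ i j : Fin n, (j : ℕ) < i → ∀ b ∈ C j, x * b ∈ C i)
    (hy : ∀ i j : Fin n, (i : ℕ) = j + 1 → ∀ b ∈ C j, y * b ∈ C i)
    (hxy : ∀ i j : Fin n, (i : ℕ) = 0 → (j : ℕ) + 1 = n → ∀ b ∈ C j, xi * y * b ∈ C i)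
    {i j : Fin n} {a b : B} (ha : a ∈ orderEntry A x y xi i j) (hb : b ∈ C j) :
    a * b ∈ C i := by
  rw [mul_comm]
  unfold orderEntry at ha
  split_ifs at ha with c1 c2 c3 <;> refine mem_of_span ?_ ha <;>
    simp only [Set.mem_insert_iff, Set.mem_singleton_iff, forall_eq_or_imp, forall_eq,
      mul_comm b]
  · exact ⟨h1 _ _ (by omega) _ hb, hxy _ _ c1.1 c1.2 _ hb⟩
  · exact h1 _ _ c2 _ hb
  · exact ⟨hx _ _ (by omega) _ hb, hy _ _ c3 _ hb⟩
  · exact hx _ _ (by omega) _ hb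

theorem one_mem_orderEntry (i : Fin n) : (1 : B) ∈ orderEntry A x y xi i i := by
  unfold orderEntry
  split_ifs
  · exact Submodule.subset_span (by simp)
  · exact Submodule.subset_span (by simp)
  all_goals exact absurd le_rfl ‹_›

theorem orderEntry_mul (hX : x ∈ Set.range (algebraMap A B)) (hY : y ∈ Set.range (algebraMap A B))
    (hx : x * xi = 1) (hy : y * y = x * y) {i j k : Fin n} {a b : B}
    (ha : a ∈ orderEntry A x y xi i j) (hb : b ∈ orderEntry A x y xi j k) :
    a * b ∈ orderEntry A x y xi i k := by
  refine orderEntry_mul_of_stable (C := fun i => orderEntry A x y xi i k) ?_ ?_ ?_ ?_ ha hb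
  all_goals
    clear ha hb a b i j
    intro i j
    intros
    rename_i b hb
    have hi := i.2
    have hj := j.2
    have hk := k.2
    unfold orderEntry at *
    simp only [Fin.le_def] at *
    split_ifs at * <;> first
    | (exfalso; omega)
    | (refine mem_of_span ?_ hb
       clear * - hX hY hx hy
       simp only [Set.mem_insert_iff, Set.mem_singleton_iff, forall_eq_or_imp, forall_eq]
       (try and_intros) <;> first
         | (apply Submodule.subset_span; simp; done)
         | (refine mem_span_of_eq (g := 1) ?_ ?_ <;> [(simp; done); (clear hX hY; grind)])
         | (refine mul_mem_span hX (g := 1) ?_ ?_ <;> [(simp; done); (clear hX hY; grind)])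
         | (refine mul_mem_span hY (g := 1) ?_ ?_ <;> [(simp; done); (clear hX hY; grind)])
         | (refine mem_span_of_eq (g := x) ?_ ?_ <;> [(simp; done); (clear hX hY; grind)])
         | (refine mul_mem_span hX (g := x) ?_ ?_ <;> [(simp; done); (clear hX hY; grind)])
         | (refine mul_mem_span hY (g := x) ?_ ?_ <;> [(simp; done); (clear hX hY; grind)])
         | (refine mem_span_of_eq (g := xi * y) ?_ ?_ <;> [(simp; done); (clear hX hY; grind)]))

set_option maxHeartbeats 1000000 in
theorem orderEntry_mul_columnEntry (hX : x ∈ Set.range (algebraMap A B))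
    (hY : y ∈ Set.range (algebraMap A B)) (hx : x * xi = 1) (hy : y * y = x * y) {e : Edge n}
    {i j : Fin n} {a b : B} (ha : a ∈ orderEntry A x y xi i j) (hb : b ∈ columnEntry A x y e j) :
    a * b ∈ columnEntry A x y e i := by
  refine orderEntry_mul_of_stable (C := columnEntry A x y e) ?_ ?_ ?_ ?_ ha hb
  all_goals
    clear ha hb a b i j
    intro i j
    intros
    rename_i b hb
    have hi := i.2
    have hj := j.2
    rcases e with ⟨r, s, hrs⟩ | r | r
    all_goals
      simp only [columnEntry, Fin.le_def, Fin.lt_def] at *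
      split_ifs at * <;> first
      | (exfalso; omega)
      | (refine mem_of_span ?_ hb
         clear * - hX hY hx hy
         simp only [Set.mem_insert_iff, Set.mem_singleton_iff, forall_eq_or_imp, forall_eq]
         (try and_intros) <;> first
           | (apply Submodule.subset_span; simp; done)
           | (refine mem_span_of_eq (g := 1) ?_ ?_ <;> [(simp; done); (clear hX hY; grind)])
           | (refine mul_mem_span hX (g := 1) ?_ ?_ <;> [(simp; done); (clear hX hY; grind)])
           | (refine mul_mem_span hY (g := 1) ?_ ?_ <;> [(simp; done); (clear hX hY; grind)])
           | (refine mem_span_of_eq (g := x) ?_ ?_ <;> [(simp; done); (clear hX hY; grind)])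
           | (refine mul_mem_span hX (g := x) ?_ ?_ <;> [(simp; done); (clear hX hY; grind)])
           | (refine mul_mem_span hY (g := x) ?_ ?_ <;> [(simp; done); (clear hX hY; grind)])
           | (refine mem_span_of_eq (g := y) ?_ ?_ <;> [(simp; done); (clear hX hY; grind)])
           | (refine mul_mem_span hX (g := y) ?_ ?_ <;> [(simp; done); (clear hX hY; grind)])
           | (refine mem_span_of_eq (g := x ^ 2) ?_ ?_ <;> [(simp; done); (clear hX hY; grind)])
           | (refine mul_mem_span hX (g := x ^ 2) ?_ ?_ <;> [(simp; done); (clear hX hY; grind)])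
           | (refine mul_mem_span hY (g := x ^ 2) ?_ ?_ <;> [(simp; done); (clear hX hY; grind)])
           | (refine mem_span_of_eq (g := y ^ 2) ?_ ?_ <;> [(simp; done); (clear hX hY; grind)])
           | (refine mul_mem_span hX (g := y ^ 2) ?_ ?_ <;> [(simp; done); (clear hX hY; grind)])
           | (refine mem_span_of_eq (g := x - y) ?_ ?_ <;> [(simp; done); (clear hX hY; grind)])
           | (refine mul_mem_span hX (g := x - y) ?_ ?_ <;> [(simp; done); (clear hX hY; grind)])
           | (refine mul_mem_span hY (g := x - y) ?_ ?_ <;> [(simp; done); (clear hX hY; grind)])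
           | (refine mem_span_of_eq (g := x ^ 2 - y ^ 2) ?_ ?_ <;> [(simp; done); (clear hX hY; grind)])
           | (refine mul_mem_span hX (g := x ^ 2 - y ^ 2) ?_ ?_ <;> [(simp; done); (clear hX hY; grind)])
           | (refine mul_mem_span hY (g := x ^ 2 - y ^ 2) ?_ ?_ <;> [(simp; done); (clear hX hY; grind)]))

end Entries

/-! ### The order `Λ` and its modules `M_a` -/

section Order

variable (K : Type*) [Field K]

/-- The ring `R' = K[X, Y] / (Y (X - Y))`, as an algebra over `R = K[X]`. In `K[X][X]` the inner
variable `C X` is `X` and the outer variable `X` is `Y`. -/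
abbrev RPrime : Type _ := AdjoinRoot (X * (C X - X) : K[X][X])

/-- The ring `R'[X⁻¹]`. -/
def RPrimeInv : Type _ := Localization.Away (algebraMap K[X] (RPrime K) X)

noncomputable instance : CommRing (RPrimeInv K) :=
  inferInstanceAs (CommRing (Localization.Away (algebraMap K[X] (RPrime K) X)))

noncomputable instance : Algebra (RPrime K) (RPrimeInv K) :=
  inferInstanceAs (Algebra (RPrime K) (Localization.Away (algebraMap K[X] (RPrime K) X)))

noncomputable instance : Algebra K[X] (RPrimeInv K) :=
  inferInstanceAs (Algebra K[X] (Localization.Away (algebraMap K[X] (RPrime K) X)))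

instance : IsScalarTower K[X] (RPrime K) (RPrimeInv K) :=
  inferInstanceAs (IsScalarTower K[X] (RPrime K)
    (Localization.Away (algebraMap K[X] (RPrime K) X)))

instance : IsLocalization.Away (algebraMap K[X] (RPrime K) X) (RPrimeInv K) :=
  inferInstanceAs (IsLocalization.Away (algebraMap K[X] (RPrime K) X)
    (Localization.Away (algebraMap K[X] (RPrime K) X)))

/-- The element `X` of `R'[X⁻¹]`. -/
noncomputable def x : RPrimeInv K := algebraMap (RPrime K) (RPrimeInv K) (algebraMap K[X] _ X)

/-- The element `Y` of `R'[X⁻¹]`. -/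
noncomputable def y : RPrimeInv K := algebraMap (RPrime K) (RPrimeInv K) (AdjoinRoot.root _)

/-- The element `X⁻¹` of `R'[X⁻¹]`. -/
noncomputable def xInv : RPrimeInv K :=
  IsLocalization.Away.invSelf (algebraMap K[X] (RPrime K) X)

theorem x_mul_xInv : x K * xInv K = 1 :=
  IsLocalization.Away.mul_invSelf _

theorem y_mul_y : y K * y K = x K * y K := by
  have h2 : (AdjoinRoot.root (X * (C X - X) : K[X][X])) *
      (algebraMap K[X] (RPrime K) X - AdjoinRoot.root _) = 0 :=
    AdjoinRoot.mk_self (f := (X * (C X - X) : K[X][X]))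
  have h3 := congrArg (algebraMap (RPrime K) (RPrimeInv K)) h2
  simp only [map_mul, map_sub, map_zero] at h3
  change y K * (x K - y K) = 0 at h3
  linear_combination -h3

variable (n : ℕ)

/-- The order `Λ`, as an algebra over `R = K[X]`: the `n × n` matrices over `R'[X⁻¹]` whose
entries lie in the prescribed `R'`-submodules. -/
noncomputable def LambdaOrder : Subalgebra K[X] (Matrix (Fin n) (Fin n) (RPrimeInv K)) where
  carrier := {A | ∀ i j, A i j ∈ orderEntry (RPrime K) (x K) (y K) (xInv K) i j}
  mul_mem' {A B} hA hB i j := by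
    rw [Matrix.mul_apply]
    exact Submodule.sum_mem _ fun k _ =>
      orderEntry_mul ⟨_, rfl⟩ ⟨_, rfl⟩ (x_mul_xInv K) (y_mul_y K) (hA i k) (hB k j)
  add_mem' {A B} hA hB i j := Submodule.add_mem _ (hA i j) (hB i j)
  algebraMap_mem' r i j := by
    rw [Matrix.algebraMap_matrix_apply]
    split_ifs with h
    · subst h
      have := (orderEntry (RPrime K) (x K) (y K) (xInv K) i i).smul_mem
        (algebraMap K[X] (RPrime K) r) (one_mem_orderEntry i)
      rwa [Algebra.smul_def, mul_one, ← IsScalarTower.algebraMap_apply] at this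
    · exact Submodule.zero_mem _

theorem order_smul_apply (A : LambdaOrder K n) (v : Fin n → RPrimeInv K) (i : Fin n) :
    (A • v) i = ∑ j, A.1 i j * v j :=
  rfl

instance : IsScalarTower K[X] (LambdaOrder K n) (Fin n → RPrimeInv K) where
  smul_assoc r A v := Matrix.smul_mulVec r A.1 v

variable {n}

/-- The left `Λ`-module `M_a` attached to a side or tagged arc `a`: the column vectors over
`R'[X⁻¹]` whose coordinates lie in the prescribed `R'`-submodules, on which `Λ` acts by matrix
multiplication. -/
noncomputable def columnModule (a : Edge n) : Submodule (LambdaOrder K n) (Fin n → RPrimeInv K) where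
  carrier := {v | ∀ i, v i ∈ columnEntry (RPrime K) (x K) (y K) a i}
  add_mem' {v w} hv hw i := Submodule.add_mem _ (hv i) (hw i)
  zero_mem' i := Submodule.zero_mem _
  smul_mem' A v hv i := by
    rw [order_smul_apply]
    exact Submodule.sum_mem _ fun j _ =>
      orderEntry_mul_columnEntry ⟨_, rfl⟩ ⟨_, rfl⟩ (x_mul_xInv K) (y_mul_y K) (A.2 i j) (hv j)

noncomputable instance (a : Edge n) : Module (LambdaOrder K n) (columnModule K a) :=
  Submodule.module (columnModule K a)

noncomputable instance (a : Edge n) : SMul (LambdaOrder K n) (columnModule K a) :=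
  (columnModule K a).module.toSMul

noncomputable instance (a : Edge n) : Module K[X] (columnModule K a) :=
  Submodule.module' (columnModule K a)

instance (a : Edge n) : IsScalarTower K[X] (LambdaOrder K n) (columnModule K a) :=
  Submodule.isScalarTower' (columnModule K a)

end Order

end PuncturedPolygon

/-!
Write `e = X⁻¹Y`, the idempotent of `R'[X⁻¹]` that projects onto the component `Y = X`; the other
component is `Y = 0`.

A module over `R = K[X]` has zero socle exactly when it is torsion free, so a Cohen-Macaulay
`Λ`-module `M` is a lattice over `K[X]`. Let `V` be the localization at `X` of the first coordinates
`E_{11} M`. The images of `M` in `V` under the matrix units `E_{1i}` extend periodically to a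
decreasing sequence of `R'`-lattices `C_z`, `z ∈ ℤ`, with `X C_z = C_{z+n}` and `Y C_z ⊆ C_{z+1}`
(`IsLatticeChain`), and the whole `Λ`-module `M` is recovered from this chain.

Existence of decompositions: it suffices to split off one `M_a` from a nonzero chain
(`IsLatticeChain.exists_isSummand`) and to induct on the rank. Let `k` be minimal with
`e C_z ⊆ C_{z-k}` for all `z`; then `k < n`.
* If `k = 0`, the chain is the sum of its two components, and an element of a component in which the
  chain jumps splits off some `(P_r, *)` or `(P_r, ⋈)`
  (`IsLatticeChain.exists_rank_one_summand`).
* If `k > 0`, there is an `m ∈ C_j` with `e m ∉ C_{j-k+1}`. Put `Q = C_{j-k+1}` and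
  `Q' = e Q + (1 - e) Q`. As `X Q' ⊆ Q`, some functional `γ : Q'/Q → K` has `γ (e m) = 1`. Because
  `γ` vanishes on `Q`, it restricts to opposite functionals on `(1 - e) Q` and `e Q`; lifts of `-γ`
  and `γ` to `K[X]`-linear functionals on these lattices agree modulo `X` on elements of `Q`, and
  `R'` consists of the pairs of polynomials that agree modulo `X`. So together they form a
  retraction that maps `Q` to `R'`, and it splits off some `(P_r, P_s)`
  (`IsLatticeChain.exists_rank_two_summand`).

Uniqueness: homomorphisms `M_a → M_b` are multiplications by scalars of `R'[X⁻¹]`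
(`apply_eq_homScalar_mul`). Taking the constant term of the scalar in a component on which `M_b` is
not zero yields a multiplicative character `residueChar` of `End M_b` with values in `K`. It kills
whatever factors through some `M_a` with `a ≠ b` (`residueChar_comp_of_ne`), since the exponents of
`X` in the coordinates of `M_a` determine `a`; and it is nonzero on nonzero idempotents. Hence `M_b`
is indecomposable, and an isomorphism of direct sums induces invertible matrices over `K` between
the multiplicity spaces of each `M_b` (`multiplicity_le_of_leftInverse`).
-/

/-! ### The socle of a module over a polynomial ring -/

section CohenMacaulay

variable {K : Type*} [Field K] {M : Type*} [AddCommGroup M] [Module K[X] M]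

theorem isSimpleModule_span_singleton_of_irreducible_smul {q : K[X]} (hq : Irreducible q) {m : M}
    (hm : m ≠ 0) (h : q • m = 0) : IsSimpleModule K[X] (Submodule.span K[X] {m}) := by
  have hker : LinearMap.ker (LinearMap.toSpanSingleton K[X] M m) = Ideal.span {q} := by
    have hmax := PrincipalIdealRing.isMaximal_of_irreducible hq
    refine (hmax.eq_of_le ?_ ?_).symm
    · rw [Ne, Ideal.eq_top_iff_one]
      simpa using hm
    · rw [Ideal.span_singleton_le_iff_mem]
      simpa using h
  rw [← LinearMap.range_toSpanSingleton]
  have hmax : Ideal.IsMaximal (LinearMap.ker (LinearMap.toSpanSingleton K[X] M m)) := by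
    rw [hker]
    exact PrincipalIdealRing.isMaximal_of_irreducible hq
  have : IsSimpleModule K[X] (K[X] ⧸ LinearMap.ker (LinearMap.toSpanSingleton K[X] M m)) :=
    isSimpleModule_iff_isCoatom.2 hmax.out
  exact IsSimpleModule.congr (LinearMap.quotKerEquivRange _).symm

theorem moduleSocle_eq_bot_iff_isTorsionFree :
    moduleSocle K[X] M = ⊥ ↔ Module.IsTorsionFree K[X] M := by
  constructor
  · intro h
    have hirr : ∀ q : K[X], Irreducible q → ∀ m : M, q • m = 0 → m = 0 := by
      intro q hq m hqm
      by_contra hm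
      have hs := isSimpleModule_span_singleton_of_irreducible_smul hq hm hqm
      have hle : Submodule.span K[X] {m} ≤ moduleSocle K[X] M := le_sSup hs
      rw [h, le_bot_iff, Submodule.span_singleton_eq_bot] at hle
      exact hm hle
    have key : ∀ p : K[X], p ≠ 0 → ∀ m : M, p • m = 0 → m = 0 := by
      intro p
      induction p using UniqueFactorizationMonoid.induction_on_prime with
      | h₁ => intro h; exact absurd rfl h
      | h₂ a ha =>
        intro _ m hm
        exact (ha.smul_eq_zero).1 hm
      | h₃ a p ha hp ih =>
        intro _ m hm
        rw [mul_smul] at hm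
        exact ih ha m (hirr p hp.irreducible _ hm)
    refine Module.IsTorsionFree.of_smul_eq_zero fun p m hpm => ?_
    by_cases hp : p = 0
    · exact Or.inl hp
    · exact Or.inr (key p hp m hpm)
  · intro h
    rw [moduleSocle, sSup_eq_bot]
    intro N hN
    have hN : IsSimpleModule K[X] N := hN
    have := IsSimpleModule.nontrivial K[X] N
    obtain ⟨a, ha⟩ := exists_ne (0 : N)
    have hmax := IsSimpleModule.ker_toSpanSingleton_isMaximal K[X] ha
    refine absurd ?_ (Ring.ne_bot_of_isMaximal_of_not_isField hmax (Polynomial.not_isField K))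
    rw [LinearMap.ker_eq_bot']
    intro p hp
    exact (smul_eq_zero.1 hp).resolve_right ha

end CohenMacaulay

namespace PuncturedPolygon

/-! ### The ring `R'[X⁻¹]` and its two components -/

section Ring

variable (K : Type*) [Field K]

theorem isUnit_x : IsUnit (x K) := IsUnit.of_mul_eq_one _ (x_mul_xInv K)

theorem algebraMap_X : algebraMap K[X] (RPrimeInv K) X = x K :=
  IsScalarTower.algebraMap_apply K[X] (RPrime K) (RPrimeInv K) X

/-- The idempotent `X⁻¹Y` of `R'[X⁻¹]`: it is the projection onto the component `Y = X`. -/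
noncomputable def idem : RPrimeInv K := xInv K * y K

theorem x_mul_idem : x K * idem K = y K := by
  rw [idem, ← mul_assoc, x_mul_xInv, one_mul]

theorem idem_mul_idem : idem K * idem K = idem K := by
  have h1 := x_mul_xInv K
  have h2 := y_mul_y K
  simp only [idem]
  linear_combination xInv K ^ 2 * h2 + xInv K * y K * h1

theorem one_sub_idem_mul_self : (1 - idem K) * (1 - idem K) = 1 - idem K := by
  linear_combination idem_mul_idem K

theorem y_mul_idem : y K * idem K = y K := by
  rw [← x_mul_idem, mul_assoc, idem_mul_idem]

variable {K}

theorem rPrime_exists_eq (a : RPrime K) :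
    ∃ f g : K[X], algebraMap (RPrime K) (RPrimeInv K) a =
      algebraMap K[X] _ f + algebraMap K[X] _ g * y K := by
  induction a using AdjoinRoot.induction_on with
  | ih p =>
  induction p using Polynomial.induction_on' with
  | add p q hp hq =>
    obtain ⟨f, g, h⟩ := hp
    obtain ⟨f', g', h'⟩ := hq
    refine ⟨f + f', g + g', ?_⟩
    simp only [map_add, h, h']
    ring
  | monomial k c =>
    induction k with
    | zero =>
      refine ⟨c, 0, ?_⟩
      rw [map_zero, zero_mul, add_zero, Polynomial.monomial_zero_left, AdjoinRoot.mk_C,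
        IsScalarTower.algebraMap_apply K[X] (RPrime K) (RPrimeInv K) c]
      rfl
    | succ k ih =>
      obtain ⟨f, g, h⟩ := ih
      refine ⟨0, f + X * g, ?_⟩
      rw [← Polynomial.monomial_mul_X, map_mul, map_mul, h, AdjoinRoot.mk_X]
      change _ * y K = _
      rw [map_add, map_mul, algebraMap_X, map_zero]
      linear_combination algebraMap K[X] _ g * y_mul_y K

theorem exists_x_pow_mul_eq (b : RPrimeInv K) :
    ∃ (N : ℕ) (a : RPrime K), x K ^ N * b = algebraMap (RPrime K) _ a := by
  obtain ⟨N, a, h⟩ := IsLocalization.Away.surj (algebraMap K[X] (RPrime K) X) b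
  exact ⟨N, a, by rw [mul_comm]; exact h⟩

theorem exists_x_pow_mul_eq_add (b : RPrimeInv K) :
    ∃ (N : ℕ) (f g : K[X]), x K ^ N * b =
      algebraMap K[X] _ f + algebraMap K[X] _ g * y K := by
  obtain ⟨N, a, h⟩ := exists_x_pow_mul_eq b
  obtain ⟨f, g, h'⟩ := rPrime_exists_eq a
  exact ⟨N, f, g, h.trans h'⟩

/-- The ring homomorphism `R'[X⁻¹] → K((X))` sending `X` to `X` and `Y` to a root `w` of
`w (X - w)`. -/
noncomputable def laurentHom (w : LaurentSeries K)
    (hw : w * (algebraMap K[X] (LaurentSeries K) X - w) = 0) : RPrimeInv K →+* LaurentSeries K :=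
  IsLocalization.Away.lift (S := RPrimeInv K) (algebraMap K[X] (RPrime K) X)
    (g := AdjoinRoot.lift (algebraMap K[X] (LaurentSeries K)) w (by simpa using hw)) (by
      rw [AdjoinRoot.algebraMap_eq, AdjoinRoot.lift_of]
      refine IsUnit.mk0 _ ?_
      rw [Ne, map_eq_zero_iff _ (FaithfulSMul.algebraMap_injective _ _)]
      exact X_ne_zero)

theorem laurentHom_y (w : LaurentSeries K) (hw) : laurentHom w hw (y K) = w := by
  rw [laurentHom, y, IsLocalization.Away.lift_eq, AdjoinRoot.lift_root]

theorem laurentHom_algebraMap (w : LaurentSeries K) (hw) (p : K[X]) :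
    laurentHom w hw (algebraMap K[X] _ p) = algebraMap K[X] (LaurentSeries K) p := by
  rw [laurentHom, IsScalarTower.algebraMap_apply K[X] (RPrime K) (RPrimeInv K),
    IsLocalization.Away.lift_eq, AdjoinRoot.algebraMap_eq, AdjoinRoot.lift_of]

/-- The component `Y = 0` of `R'[X⁻¹]`, with values in `K((X))`. -/
noncomputable def compZero : RPrimeInv K →+* LaurentSeries K := laurentHom 0 (by simp)

/-- The component `Y = X` of `R'[X⁻¹]`, with values in `K((X))`. -/
noncomputable def compX : RPrimeInv K →+* LaurentSeries K :=
  laurentHom (algebraMap K[X] (LaurentSeries K) X) (by simp)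

theorem eq_zero_of_comp_eq_zero {b : RPrimeInv K} (h0 : compZero b = 0) (h1 : compX b = 0) :
    b = 0 := by
  obtain ⟨N, f, g, h⟩ := exists_x_pow_mul_eq_add b
  have e0 := congrArg compZero h
  have e1 := congrArg compX h
  rw [map_mul, h0, mul_zero, map_add, map_mul, compZero, laurentHom_y, laurentHom_algebraMap,
    mul_zero, add_zero, eq_comm, map_eq_zero_iff _ (FaithfulSMul.algebraMap_injective _ _)] at e0
  rw [map_mul, h1, mul_zero, map_add, map_mul, compX, laurentHom_y, laurentHom_algebraMap,
    laurentHom_algebraMap, e0, map_zero, zero_add, ← map_mul, eq_comm,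
    map_eq_zero_iff _ (FaithfulSMul.algebraMap_injective _ _)] at e1
  have hg : g = 0 := (mul_eq_zero.1 e1).resolve_right X_ne_zero
  rw [e0, hg, map_zero, zero_mul, add_zero] at h
  exact (((isUnit_x K).pow N).mul_right_eq_zero).1 h

instance : Module.IsTorsionFree K[X] (RPrimeInv K) := by
  refine Module.IsTorsionFree.of_smul_eq_zero fun p b h => ?_
  by_cases hp : p = 0
  · exact Or.inl hp
  right
  have hp' : algebraMap K[X] (LaurentSeries K) p ≠ 0 := by
    rwa [Ne, map_eq_zero_iff _ (FaithfulSMul.algebraMap_injective _ _)]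
  rw [Algebra.smul_def] at h
  refine eq_zero_of_comp_eq_zero ?_ ?_
  · have := congrArg compZero h
    rw [map_mul, compZero, laurentHom_algebraMap, map_zero] at this
    exact (mul_eq_zero.1 this).resolve_left hp'
  · have := congrArg compX h
    rw [map_mul, compX, laurentHom_algebraMap, map_zero] at this
    exact (mul_eq_zero.1 this).resolve_left hp'

end Ring

end PuncturedPolygon

/-! ### Residue functionals on lattices over `K[X]` -/

section Residue

variable {K : Type*} [Field K] {Q : Type*} [AddCommGroup Q] [Module K[X] Q]

theorem Polynomial.exists_eq_C_eval_zero_add_X_mul (p : K[X]) : ∃ q, p = C (p.eval 0) + X * q :=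
  ⟨p.divX, by rw [← coeff_zero_eq_eval_zero, add_comm, X_mul_divX_add]⟩

theorem Polynomial.exists_eq_X_mul_of_eval_zero {p : K[X]} (hp : p.eval 0 = 0) :
    ∃ q, p = X * q := by
  obtain ⟨q, hq⟩ := p.exists_eq_C_eval_zero_add_X_mul
  exact ⟨q, by rw [hq, hp, map_zero, zero_add]⟩

/-- Linear functionals on the `K`-vector space `Q / U`, where `X Q ⊆ U`, separate points. They are
encoded as additive maps on `Q` on which polynomials act through their constant terms. -/
theorem exists_residue_functional (U : Submodule K[X] Q) (hX : ∀ q, (X : K[X]) • q ∈ U) {m : Q}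
    (hm : m ∉ U) : ∃ f : Q →+ K, f m = 1 ∧ (∀ u ∈ U, f u = 0) ∧
      ∀ (p : K[X]) (q : Q), f (p • q) = p.eval 0 * f q := by
  let _ : Module K (Q ⧸ U) := Module.compHom _ (C : K →+* K[X])
  have hm' : U.mkQ m ≠ 0 := by simpa using hm
  obtain ⟨f, hf⟩ : ∃ f : Module.Dual K (Q ⧸ U), f (U.mkQ m) ≠ 0 := by
    by_contra! h
    exact hm' ((Module.forall_dual_apply_eq_zero_iff K _).1 h)
  refine ⟨(AddMonoidHom.mulLeft (f (U.mkQ m))⁻¹).comp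
    (f.toAddMonoidHom.comp U.mkQ.toAddMonoidHom), inv_mul_cancel₀ hf, fun u hu => ?_,
    fun p q => ?_⟩
  · change _ * f (U.mkQ u) = 0
    have h1 : U.mkQ u = 0 := (Submodule.Quotient.mk_eq_zero U).2 hu
    rw [h1, map_zero, mul_zero]
  · change _ * f (U.mkQ (p • q)) = _ * (_ * f (U.mkQ q))
    obtain ⟨p', hp'⟩ := p.exists_eq_C_eval_zero_add_X_mul
    have h1 : U.mkQ (p • q) = (p.eval 0) • U.mkQ q := by
      change _ = (C (p.eval 0) : K[X]) • U.mkQ q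
      conv_lhs => rw [hp', add_smul, mul_comm, mul_smul, map_add, map_smul, map_smul]
      have h2 : U.mkQ ((X : K[X]) • q) = 0 := (Submodule.Quotient.mk_eq_zero U).2 (hX q)
      rw [h2, smul_zero, add_zero]
    rw [h1, map_smul, smul_eq_mul, mul_left_comm]

/-- A functional on `L / X L` lifts to a `K[X]`-linear functional on a lattice `L`, and the lift
can be chosen surjective unless the functional vanishes. -/
theorem exists_linearMap_lift_residue [Module.Finite K[X] Q] [Module.IsTorsionFree K[X] Q]
    (f : Q →+ K) (hf : ∀ (p : K[X]) (q : Q), f (p • q) = p.eval 0 * f q) :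
    ∃ α : Q →ₗ[K[X]] K[X], (∀ q, (α q).eval 0 = f q) ∧
      ((∃ q, f q ≠ 0) → Function.Surjective α) := by
  let b := Module.Free.chooseBasis K[X] Q
  let α : Q →ₗ[K[X]] K[X] := b.constr ℕ fun i => C (f (b i))
  have hα : ∀ i, α (b i) = C (f (b i)) := fun i => b.constr_basis ℕ _ i
  have hev : ∀ q, (α q).eval 0 = f q := by
    intro q
    induction b.mem_span q using Submodule.span_induction with
    | mem _ h => obtain ⟨i, rfl⟩ := h; rw [hα, eval_C]
    | zero => rw [map_zero, map_zero, eval_zero]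
    | add p q _ _ hp hq => rw [map_add, map_add, eval_add, hp, hq]
    | smul p q _ hq => rw [map_smul, smul_eq_mul, eval_mul, hq, hf]
  refine ⟨α, hev, fun ⟨q, hq⟩ => ?_⟩
  obtain ⟨i, hi⟩ : ∃ i, f (b i) ≠ 0 := by
    by_contra! h
    have h0 : α = 0 := b.ext fun i => by rw [hα, h, map_zero, LinearMap.zero_apply]
    exact hq (by rw [← hev, h0, LinearMap.zero_apply, eval_zero])
  intro p
  refine ⟨(p * C (f (b i))⁻¹) • b i, ?_⟩
  rw [map_smul, hα, smul_eq_mul, mul_assoc, ← C_mul, inv_mul_cancel₀ hi, C_1, mul_one]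

/-- Starting from an element whose value is congruent to `1` modulo `X`, a correction by multiples
of that element and of `X²` yields the value `1`. -/
theorem exists_correction {α : Q →ₗ[K[X]] K[X]} (hα : Function.Surjective α) {m : Q}
    (hm : (α m).eval 0 = 1) :
    ∃ (g : K[X]) (b : Q), α (m - (X * g) • m + (X ^ 2 : K[X]) • b) = 1 := by
  obtain ⟨g, hg⟩ := (α m).exists_eq_C_eval_zero_add_X_mul
  obtain ⟨b, hb⟩ := hα (g ^ 2)
  refine ⟨g, b, ?_⟩
  rw [map_add, map_sub, map_smul, map_smul, hb, hg, hm, C_1, smul_eq_mul, smul_eq_mul]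
  ring

end Residue

namespace PuncturedPolygon

/-! ### Lattice chains -/

section LatticeChain

set_option linter.unusedSectionVars false

variable {K : Type*} [Field K]

/-- In the component `Y = X`, the ring `R'[X⁻¹]` is `K[X, X⁻¹]`. -/
theorem exists_x_pow_mul_mul_idem (b : RPrimeInv K) :
    ∃ (N : ℕ) (p : K[X]), x K ^ N * b * idem K = algebraMap K[X] _ p * idem K := by
  obtain ⟨N, f, g, h⟩ := exists_x_pow_mul_eq_add b
  refine ⟨N, f + g * X, ?_⟩
  rw [h, map_add, map_mul, algebraMap_X]
  linear_combination algebraMap K[X] (RPrimeInv K) g * (y_mul_idem K - x_mul_idem K)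

/-- In the component `Y = 0`, the ring `R'[X⁻¹]` is `K[X, X⁻¹]`. -/
theorem exists_x_pow_mul_mul_one_sub_idem (b : RPrimeInv K) :
    ∃ (N : ℕ) (p : K[X]), x K ^ N * b * (1 - idem K) = algebraMap K[X] _ p * (1 - idem K) := by
  obtain ⟨N, f, g, h⟩ := exists_x_pow_mul_eq_add b
  refine ⟨N, f, ?_⟩
  rw [h]
  linear_combination - algebraMap K[X] (RPrimeInv K) g * (y_mul_idem K)

theorem x_pow_smul_cancel {V : Type*} [AddCommGroup V] [Module (RPrimeInv K) V] {N : ℕ} {v w : V}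
    (h : x K ^ N • v = x K ^ N • w) : v = w :=
  ((isUnit_x K).pow N).smul_left_cancel.1 h

variable {V : Type*} [AddCommGroup V] [Module K[X] V] [Module (RPrime K) V]
  [Module (RPrimeInv K) V] [IsScalarTower K[X] (RPrimeInv K) V]
  [IsScalarTower (RPrime K) (RPrimeInv K) V] [IsScalarTower K[X] (RPrime K) V]

/-- A `K[X]`-linear functional on a lattice in the component `ε V` extends to an
`R'[X⁻¹]`-linear map on `V`. -/
theorem exists_linearMap_extension {ε : RPrimeInv K} (hε : ε * ε = ε)
    (hB : ∀ b, ∃ (N : ℕ) (p : K[X]), x K ^ N * b * ε = algebraMap K[X] _ p * ε)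
    (L : Submodule K[X] V) (hL : ∀ l ∈ L, ε • l = l)
    (hspan : ∀ v : V, ∃ N : ℕ, x K ^ N • ε • v ∈ L) (α : L →ₗ[K[X]] K[X]) :
    ∃ ρ : V →ₗ[RPrimeInv K] RPrimeInv K,
      (∀ l : L, ρ l = algebraMap K[X] _ (α l) * ε) ∧ ∀ v, ρ (ε • v) = ρ v := by
  classical
  have hpow : ∀ (M : ℕ) (l : V), l ∈ L → x K ^ M • l ∈ L := by
    intro M l hl
    have h := L.smul_mem (X ^ M) hl
    rwa [← algebraMap_smul (RPrimeInv K), map_pow, algebraMap_X] at h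
  let A : V → RPrimeInv K := fun l => if h : l ∈ L then algebraMap K[X] _ (α ⟨l, h⟩) else 0
  have hA : ∀ l (h : l ∈ L), A l = algebraMap K[X] _ (α ⟨l, h⟩) := fun l h => dif_pos h
  have hAadd : ∀ l ∈ L, ∀ l' ∈ L, A (l + l') = A l + A l' := by
    intro l h l' h'
    rw [hA _ h, hA _ h', hA _ (add_mem h h'), ← map_add, ← map_add]
    rfl
  have hAsmul : ∀ p : K[X], ∀ l ∈ L, A (algebraMap K[X] (RPrimeInv K) p • l) =
      algebraMap K[X] _ p * A l := by
    intro p l h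
    rw [algebraMap_smul, hA _ h, hA _ (L.smul_mem p h), ← map_mul, ← smul_eq_mul, ← map_smul]
    rfl
  have hApow : ∀ M : ℕ, ∀ l ∈ L, A (x K ^ M • l) = x K ^ M * A l := by
    intro M l h
    rw [← algebraMap_X, ← map_pow, hAsmul _ _ h]
  -- Clear denominators, apply `α`, and divide again.
  choose N hN using hspan
  let r : V → RPrimeInv K := fun v => xInv K ^ N v * (A (x K ^ N v • ε • v) * ε)
  have hxx : ∀ M : ℕ, x K ^ M * xInv K ^ M = 1 := fun M => by
    rw [← mul_pow, x_mul_xInv, one_pow]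
  have hr : ∀ v (M : ℕ), x K ^ (M + N v) * r v = A (x K ^ (M + N v) • ε • v) * ε := by
    intro v M
    rw [pow_add (x K) M, mul_smul, hApow _ _ (hN v)]
    simp only [r]
    linear_combination (x K ^ M * (A (x K ^ N v • ε • v) * ε)) * hxx (N v)
  have hrε : ∀ v, r v * ε = r v := by
    intro v
    simp only [r]
    linear_combination (xInv K ^ N v * A (x K ^ N v • ε • v)) * hε
  have hmem : ∀ v (M : ℕ), x K ^ (M + N v) • ε • v ∈ L := by
    intro v M
    rw [pow_add, mul_smul]
    exact hpow _ _ (hN v)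
  let ρ : V →ₗ[RPrimeInv K] RPrimeInv K :=
    { toFun := r
      map_add' := by
        intro v w
        refine x_pow_smul_cancel (K := K) (N := N v + N w + N (v + w)) ?_
        have hv := hmem v (N w + N (v + w))
        have hw := hmem w (N v + N (v + w))
        rw [show N w + N (v + w) + N v = N v + N w + N (v + w) by ring] at hv
        rw [show N v + N (v + w) + N w = N v + N w + N (v + w) by ring] at hw
        rw [smul_eq_mul, smul_eq_mul, hr, smul_add, smul_add, mul_add, hAadd _ hv _ hw]
        have h1 := hr v (N w + N (v + w))
        have h2 := hr w (N v + N (v + w))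
        rw [show N w + N (v + w) + N v = N v + N w + N (v + w) by ring] at h1
        rw [show N v + N (v + w) + N w = N v + N w + N (v + w) by ring] at h2
        rw [h1, h2, add_mul]
      map_smul' := by
        intro b v
        obtain ⟨M, p, hp⟩ := hB b
        refine x_pow_smul_cancel (K := K) (N := M + N v + N (b • v)) ?_
        rw [smul_eq_mul, smul_eq_mul, hr, RingHom.id_apply, smul_eq_mul]
        have h1 : x K ^ (M + N v + N (b • v)) • ε • b • v =
            algebraMap K[X] (RPrimeInv K) p • x K ^ (N (b • v) + N v) • ε • v := by
          simp only [smul_smul]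
          congr 1
          linear_combination (x K ^ (N v + N (b • v))) * hp
        rw [h1, hAsmul _ _ (hmem v _), mul_assoc, ← hr, ← hrε v]
        linear_combination -(x K ^ (N v + N (b • v)) * r v) * hp }
  refine ⟨ρ, fun l => ?_, fun v => ?_⟩
  · change r l = _
    refine x_pow_smul_cancel (K := K) (N := 0 + N l) ?_
    rw [smul_eq_mul, smul_eq_mul, hr, hL _ l.2, hApow _ _ l.2, hA _ l.2, mul_assoc]
  · change r (ε • v) = r v
    refine x_pow_smul_cancel (K := K) (N := N v + N (ε • v)) ?_
    have h1 := hr v (N (ε • v))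
    rw [add_comm] at h1
    rw [smul_eq_mul, smul_eq_mul, h1, hr, smul_smul ε ε, hε]

variable (n : ℕ) (C : ℤ → Submodule (RPrime K) V)

/-- A `Λ`-lattice in concrete form: a decreasing sequence of `R'`-lattices `C i` of `V` which is
periodic up to multiplication by `X` and satisfies `Y (C i) ⊆ C (i + 1)`. For `0 ≤ i < n` the
term `C i` plays the role of the `i`-th coordinates of a module of column vectors. -/
structure IsLatticeChain : Prop where
  step : ∀ i, C (i + 1) ≤ C i
  x_smul_mem_iff : ∀ i v, x K • v ∈ C (i + n) ↔ v ∈ C i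
  y_smul_mem : ∀ i, ∀ v ∈ C i, y K • v ∈ C (i + 1)
  finite : ∀ i, Module.Finite K[X] (C i)
  exists_x_pow_smul_mem : ∀ i v, ∃ N : ℕ, x K ^ N • v ∈ C i

end LatticeChain

/-! ### Splitting off summands of rank one and two -/

section Summands

set_option linter.unusedSectionVars false

variable {K : Type*} [Field K] {V : Type*} [AddCommGroup V] [Module K[X] V] [Module (RPrime K) V]
  [Module (RPrimeInv K) V] [IsScalarTower K[X] (RPrimeInv K) V]
  [IsScalarTower (RPrime K) (RPrimeInv K) V] [IsScalarTower K[X] (RPrime K) V]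

/-- The `K[X]`-submodule `ε Q` of `V`. -/
noncomputable def component (ε : RPrimeInv K) (Q : Submodule (RPrime K) V) : Submodule K[X] V :=
  (Q.restrictScalars K[X]).map (Algebra.lsmul K[X] K[X] V ε)

theorem smul_mem_component (ε : RPrimeInv K) {Q : Submodule (RPrime K) V} {q : V} (hq : q ∈ Q) :
    ε • q ∈ component ε Q :=
  ⟨q, hq, rfl⟩

theorem finite_component (ε : RPrimeInv K) (Q : Submodule (RPrime K) V) [Module.Finite K[X] Q] :
    Module.Finite K[X] (component ε Q) := by
  have h : Module.Finite K[X] (Q.restrictScalars K[X]) := ‹_›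
  rw [Module.Finite.iff_fg] at h ⊢
  exact h.map _

theorem x_smul_eq (v : V) : x K • v = (X : K[X]) • v := by
  rw [← algebraMap_X, algebraMap_smul]

theorem x_smul_idem_smul (v : V) : x K • idem K • v = y K • v := by
  rw [smul_smul, x_mul_idem]

theorem x_smul_mem_submodule {Q : Submodule (RPrime K) V} {q : V} (hq : q ∈ Q) : x K • q ∈ Q := by
  rw [x, algebraMap_smul]
  exact Q.smul_mem _ hq

theorem y_smul_mem_submodule {Q : Submodule (RPrime K) V} {q : V} (hq : q ∈ Q) : y K • q ∈ Q := by
  rw [y, algebraMap_smul]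
  exact Q.smul_mem _ hq

theorem polynomial_smul_mem {Q : Submodule (RPrime K) V} (p : K[X]) {q : V} (hq : q ∈ Q) :
    p • q ∈ Q :=
  (Q.restrictScalars K[X]).smul_mem p hq

namespace IsLatticeChain

variable {n : ℕ} {C : ℤ → Submodule (RPrime K) V} (hC : IsLatticeChain n C)
include hC

theorem antitone : Antitone C := antitone_int_of_succ_le hC.step

theorem mem_of_le {i j : ℤ} (hij : i ≤ j) {v : V} (hv : v ∈ C j) : v ∈ C i := hC.antitone hij hv

theorem x_smul_mem_of_le {i j : ℤ} (hij : j ≤ i + n) {v : V} (hv : v ∈ C i) : x K • v ∈ C j :=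
  hC.mem_of_le hij ((hC.x_smul_mem_iff i v).2 hv)

theorem exists_eq_x_smul {i : ℤ} {v : V} (hv : v ∈ C i) : ∃ w ∈ C (i - n), v = x K • w := by
  refine ⟨xInv K • v, ?_, ?_⟩
  · rw [← hC.x_smul_mem_iff, smul_smul, x_mul_xInv, one_smul, sub_add_cancel]
    exact hv
  · rw [smul_smul, x_mul_xInv, one_smul]

theorem idem_smul_mem {i : ℤ} {v : V} (hv : v ∈ C i) : idem K • v ∈ C (i + 1 - n) := by
  rw [← hC.x_smul_mem_iff, x_smul_idem_smul, sub_add_cancel]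
  exact hC.y_smul_mem i v hv

/-- Multiplication by `X ^ q` shifts the chain by `n q`, also for negative `q`. -/
theorem exists_unit_smul_mem_iff (q : ℤ) :
    ∃ u : (RPrimeInv K)ˣ, ∀ i v, u • v ∈ C (i + n * q) ↔ v ∈ C i := by
  have hx : ∀ i v, (isUnit_x K).unit • v ∈ C (i + n) ↔ v ∈ C i := hC.x_smul_mem_iff
  induction q using Int.induction_on with
  | zero => exact ⟨1, by simp⟩
  | succ q ih =>
    obtain ⟨u, hu⟩ := ih
    refine ⟨(isUnit_x K).unit * u, fun i v => ?_⟩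
    rw [mul_add, mul_one, ← add_assoc, mul_smul, hx, hu]
  | pred q ih =>
    obtain ⟨u, hu⟩ := ih
    refine ⟨(isUnit_x K).unit⁻¹ * u, fun i v => ?_⟩
    have h : i + n * (-(q : ℤ) - 1) + n = i + n * -q := by ring
    rw [← hx, mul_smul, smul_inv_smul, h, hu]

variable [Module.IsTorsionFree K[X] V]

/-- If `ε` preserves the chain, an element of `ε V` in `C j` but not in `C (j + 1)` splits off a
summand of rank one. -/
theorem exists_rank_one_summand {ε : RPrimeInv K} (hε : ε * ε = ε)
    (hB : ∀ b, ∃ (N : ℕ) (p : K[X]), x K ^ N * b * ε = algebraMap K[X] _ p * ε)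
    (hεC : ∀ i, ∀ v ∈ C i, ε • v ∈ C i) (hn : 1 ≤ n) {j : ℤ} {m₀ : V} (hm₀ : m₀ ∈ C j)
    (hεm₀ : ε • m₀ = m₀) (hm₀' : m₀ ∉ C (j + 1)) :
    ∃ (m : V) (ρ : V →ₗ[RPrimeInv K] RPrimeInv K), m ∈ C j ∧ ε • m = m ∧ ρ m = ε ∧
      ∀ v ∈ C (j + 1 - n), ∃ f : K[X], ρ v = algebraMap K[X] _ f * ε := by
  set Q := C (j + 1 - n)
  have := hC.finite (j + 1 - n)
  have := finite_component ε Q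
  have hL : ∀ l ∈ component ε Q, ε • l = l := by
    rintro _ ⟨q, -, rfl⟩
    change ε • ε • q = ε • q
    rw [smul_smul, hε]
  have hLQ : ∀ l ∈ component ε Q, l ∈ Q := by
    rintro _ ⟨q, hq, rfl⟩
    exact hεC _ _ hq
  have hjQ : ∀ v ∈ C j, v ∈ Q := fun v hv => hC.mem_of_le (by omega) hv
  have hmL : m₀ ∈ component ε Q := ⟨m₀, hjQ _ hm₀, hεm₀⟩
  let U : Submodule K[X] (component ε Q) :=
    ((C (j + 1)).restrictScalars K[X]).comap (component ε Q).subtype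
  obtain ⟨γ, hγ1, hγ2, hγ3⟩ := exists_residue_functional U (m := ⟨m₀, hmL⟩) (by
    rintro ⟨q, hq⟩
    change (X : K[X]) • q ∈ C (j + 1)
    rw [← x_smul_eq]
    exact hC.x_smul_mem_of_le (by omega) (hLQ _ hq)) hm₀'
  obtain ⟨α, hα1, hα2⟩ := exists_linearMap_lift_residue γ hγ3
  obtain ⟨g, b, hgb⟩ := exists_correction (hα2 ⟨_, by rw [hγ1]; exact one_ne_zero⟩)
    (m := ⟨m₀, hmL⟩) (by rw [hα1, hγ1])
  obtain ⟨ρ, hρ1, hρ2⟩ := exists_linearMap_extension hε hB _ hL (fun v => by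
    obtain ⟨N, hN⟩ := hC.exists_x_pow_smul_mem (j + 1 - n) v
    refine ⟨N, ?_⟩
    rw [smul_comm]
    exact smul_mem_component ε hN) α
  refine ⟨_, ρ, ?_, hL _ (Subtype.mem _), (hρ1 _).trans (by rw [hgb, map_one, one_mul]),
    fun v hv => ⟨α ⟨_, smul_mem_component ε hv⟩, by rw [← hρ1, hρ2]⟩⟩
  change m₀ - (X * g) • m₀ + (X ^ 2 : K[X]) • b.1 ∈ C j
  refine add_mem (sub_mem hm₀ (polynomial_smul_mem _ hm₀)) ?_
  rw [pow_two, mul_smul]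
  refine polynomial_smul_mem _ ?_
  rw [← x_smul_eq]
  exact hC.x_smul_mem_of_le (by omega) (hLQ _ b.2)

/-- An element `m₀` of `C j` with `e m₀ ∉ C (t + 1)`, where `e C j ⊆ C t` and
`e C (j + 1) ⊆ C (t + 1)`, splits off a summand of rank two that meets both components
nontrivially without being the sum of its components. The retraction `ρ` is assembled from lifts
`α`, `β` of opposite residue functionals on the two components of `C (t + 1)`; these agree modulo
`X` on `C (t + 1)`, which is what makes the values of `ρ` lie in `R'`. -/
theorem exists_rank_two_summand {t j : ℤ} (htj : t < j) (hjt : j < t + n) {m₀ : V}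
    (hm₀ : m₀ ∈ C j) (hm₀' : idem K • m₀ ∉ C (t + 1)) (h0 : ∀ v ∈ C j, idem K • v ∈ C t)
    (h1 : ∀ v ∈ C (j + 1), idem K • v ∈ C (t + 1)) :
    ∃ (m : V) (ρ : V →ₗ[RPrimeInv K] RPrimeInv K), m ∈ C j ∧ idem K • m ∈ C t ∧ ρ m = 1 ∧
      (∀ v ∈ C (t + 1), ρ v ∈ Submodule.span (RPrime K) {1}) ∧
      ∀ v ∈ C (j + 1), ρ v ∈ Submodule.span (RPrime K) {x K, y K} := by
  set Q := C (t + 1)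
  have := hC.finite (t + 1)
  have := finite_component (1 - idem K) Q
  have := finite_component (idem K) Q
  have hL : ∀ ε : RPrimeInv K, ε * ε = ε → ∀ l ∈ component ε Q, ε • l = l := by
    rintro ε hε _ ⟨q, -, rfl⟩
    change ε • ε • q = ε • q
    rw [smul_smul, hε]
  have hspan : ∀ (ε : RPrimeInv K) (v : V), ∃ N : ℕ, x K ^ N • ε • v ∈ component ε Q := by
    intro ε v
    obtain ⟨N, hN⟩ := hC.exists_x_pow_smul_mem (t + 1) v
    refine ⟨N, ?_⟩
    rw [smul_comm]
    exact smul_mem_component ε hN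
  have hjQ : ∀ v ∈ C j, v ∈ Q := fun v hv => hC.mem_of_le (by omega) hv
  set L₁ := component (1 - idem K) Q
  set L₂ := component (idem K) Q
  have hQL : ∀ q ∈ Q, q ∈ L₁ ⊔ L₂ := by
    intro q hq
    rw [show q = (1 - idem K) • q + idem K • q by rw [sub_smul, one_smul, sub_add_cancel]]
    exact Submodule.add_mem_sup (smul_mem_component _ hq) (smul_mem_component _ hq)
  let U : Submodule K[X] ↥(L₁ ⊔ L₂) := (Q.restrictScalars K[X]).comap (L₁ ⊔ L₂).subtype
  have hem₀ : idem K • m₀ ∈ L₂ := smul_mem_component _ (hjQ _ hm₀)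
  have hem₀' : (1 - idem K) • m₀ ∈ L₁ := smul_mem_component _ (hjQ _ hm₀)
  obtain ⟨γ, hγ1, hγ2, hγ3⟩ := exists_residue_functional U
    (m := ⟨idem K • m₀, Submodule.mem_sup_right hem₀⟩) (by
      rintro ⟨q, hq⟩
      change (X : K[X]) • q ∈ Q
      obtain ⟨_, ⟨a, ha, rfl⟩, _, ⟨b, hb, rfl⟩, rfl⟩ := Submodule.mem_sup.1 hq
      rw [← x_smul_eq]
      change x K • ((1 - idem K) • a + idem K • b) ∈ Q
      rw [sub_smul, one_smul, smul_add, smul_sub, x_smul_idem_smul, x_smul_idem_smul]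
      exact add_mem (sub_mem (x_smul_mem_submodule ha) (y_smul_mem_submodule ha))
        (y_smul_mem_submodule hb)) hm₀'
  -- The functionals on the two components are opposite to each other because `γ` vanishes on `Q`.
  let γ₁ : L₁ →+ K := -γ.comp (Submodule.inclusion le_sup_left).toAddMonoidHom
  let γ₂ : L₂ →+ K := γ.comp (Submodule.inclusion le_sup_right).toAddMonoidHom
  have hsum : ∀ v (hv : v ∈ Q),
      γ₁ ⟨_, smul_mem_component _ hv⟩ = γ₂ ⟨_, smul_mem_component _ hv⟩ := by
    intro v hv
    have h := hγ2 ⟨v, hQL v hv⟩ hv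
    rw [show (⟨v, hQL v hv⟩ : ↥(L₁ ⊔ L₂)) =
      Submodule.inclusion le_sup_left ⟨_, smul_mem_component (1 - idem K) hv⟩ +
      Submodule.inclusion le_sup_right ⟨_, smul_mem_component (idem K) hv⟩ from
      Subtype.ext (show v = (1 - idem K) • v + idem K • v by
        rw [sub_smul, one_smul, sub_add_cancel]), map_add] at h
    exact neg_eq_of_add_eq_zero_right h
  have hγm₂ : γ₂ ⟨_, hem₀⟩ = 1 := hγ1
  have hγm₁ : γ₁ ⟨_, hem₀'⟩ = 1 := (hsum _ (hjQ _ hm₀)).trans hγm₂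
  obtain ⟨α, hα1, hα2⟩ := exists_linearMap_lift_residue γ₁ (fun p q => by
    change -γ (p • Submodule.inclusion le_sup_left q) = _ * -γ (Submodule.inclusion le_sup_left q)
    rw [hγ3, mul_neg])
  obtain ⟨β, hβ1, hβ2⟩ := exists_linearMap_lift_residue γ₂ (fun p q =>
    hγ3 p (Submodule.inclusion le_sup_right q))
  -- Correct `m₀` in each component, so that both functionals take the value `1`.
  obtain ⟨g₁, ⟨_, c₁, (hc₁ : c₁ ∈ Q), rfl⟩, hgb₁⟩ := exists_correction
    (hα2 ⟨_, by rw [hγm₁]; exact one_ne_zero⟩) (by rw [hα1, hγm₁])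
  obtain ⟨g₂, ⟨_, c₂, (hc₂ : c₂ ∈ Q), rfl⟩, hgb₂⟩ := exists_correction
    (hβ2 ⟨_, by rw [hγm₂]; exact one_ne_zero⟩) (by rw [hβ1, hγm₂])
  obtain ⟨ρ₁, hρ₁, hρ₁'⟩ := exists_linearMap_extension (one_sub_idem_mul_self K)
    exists_x_pow_mul_mul_one_sub_idem L₁ (hL _ (one_sub_idem_mul_self K)) (hspan _) α
  obtain ⟨ρ₂, hρ₂, hρ₂'⟩ := exists_linearMap_extension (idem_mul_idem K)
    exists_x_pow_mul_mul_idem L₂ (hL _ (idem_mul_idem K)) (hspan _) β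
  have hρ : ∀ v (hv : v ∈ Q), (ρ₁ + ρ₂) v =
      algebraMap K[X] _ (α ⟨_, smul_mem_component _ hv⟩) * (1 - idem K) +
      algebraMap K[X] _ (β ⟨_, smul_mem_component _ hv⟩) * idem K := by
    intro v hv
    rw [LinearMap.add_apply, ← hρ₁, ← hρ₂, hρ₁', hρ₂']
  have he1 : idem K * (1 - idem K) = 0 := by rw [mul_sub, mul_one, idem_mul_idem, sub_self]
  have hcross₁ : ∀ l ∈ L₂, ρ₁ l = 0 := by
    intro l hl
    rw [← hρ₁', ← hL _ (idem_mul_idem K) l hl, smul_smul, mul_comm, he1, zero_smul, map_zero]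
  have hcross₂ : ∀ l ∈ L₁, ρ₂ l = 0 := by
    intro l hl
    rw [← hρ₂', ← hL _ (one_sub_idem_mul_self K) l hl, smul_smul, he1, zero_smul, map_zero]
  have hX₂ : ∀ (p : K[X]) (q : V), q ∈ C j → (p * X) • idem K • q ∈ C j := by
    intro p q hq
    rw [mul_smul, ← x_smul_eq, x_smul_idem_smul]
    exact polynomial_smul_mem _ (y_smul_mem_submodule hq)
  have hX₁ : ∀ (p : K[X]) (q : V), q ∈ C j → (p * X) • (1 - idem K) • q ∈ C j := by
    intro p q hq
    rw [sub_smul, one_smul, smul_sub, mul_smul, ← x_smul_eq]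
    exact sub_mem (polynomial_smul_mem _ (x_smul_mem_submodule hq)) (hX₂ _ _ hq)
  have hXX : ∀ (ε : RPrimeInv K) (c : V),
      (X ^ 2 : K[X]) • ε • c = (1 * X : K[X]) • ε • x K • c := by
    intro ε c
    rw [pow_two, one_mul, mul_smul, x_smul_eq c, smul_comm ε (X : K[X]) c]
  -- The corrections stay in `C j`, since `X (1 - e)` and `X e = Y` preserve it.
  have hm : ((1 - idem K) • m₀ - (X * g₁) • (1 - idem K) • m₀ +
        (X ^ 2 : K[X]) • (1 - idem K) • c₁) +
      (idem K • m₀ - (X * g₂) • idem K • m₀ + (X ^ 2 : K[X]) • idem K • c₂) ∈ C j := by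
    have h : ((1 - idem K) • m₀ - (X * g₁) • (1 - idem K) • m₀ +
          (X ^ 2 : K[X]) • (1 - idem K) • c₁) +
        (idem K • m₀ - (X * g₂) • idem K • m₀ + (X ^ 2 : K[X]) • idem K • c₂) =
        m₀ - (g₁ * X) • (1 - idem K) • m₀ + (1 * X : K[X]) • (1 - idem K) • x K • c₁ -
          (g₂ * X) • idem K • m₀ + (1 * X : K[X]) • idem K • x K • c₂ := by
      rw [hXX, hXX, mul_comm X g₁, mul_comm X g₂, sub_smul 1 (idem K) m₀, one_smul]
      abel
    rw [h]
    have hc : ∀ c ∈ Q, x K • c ∈ C j := fun c hc => hC.x_smul_mem_of_le (by omega) hc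
    exact add_mem (sub_mem (add_mem (sub_mem hm₀ (hX₁ _ _ hm₀)) (hX₁ _ _ (hc _ hc₁)))
      (hX₂ _ _ hm₀)) (hX₂ _ _ (hc _ hc₂))
  refine ⟨_, ρ₁ + ρ₂, hm, h0 _ hm, ?_, fun v hv => ?_, fun v hv => ?_⟩
  · have e1 := hρ₁ (⟨(1 - idem K) • m₀, hem₀'⟩ - (X * g₁) • ⟨(1 - idem K) • m₀, hem₀'⟩ +
        (X ^ 2 : K[X]) • ⟨(1 - idem K) • c₁, smul_mem_component _ hc₁⟩)
    have e2 := hρ₂ (⟨idem K • m₀, hem₀⟩ - (X * g₂) • ⟨idem K • m₀, hem₀⟩ +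
        (X ^ 2 : K[X]) • ⟨idem K • c₂, smul_mem_component _ hc₂⟩)
    have e3 := hcross₁ _ (⟨idem K • m₀, hem₀⟩ - (X * g₂) • ⟨idem K • m₀, hem₀⟩ +
        (X ^ 2 : K[X]) • ⟨idem K • c₂, smul_mem_component _ hc₂⟩ : L₂).2
    have e4 := hcross₂ _ (⟨(1 - idem K) • m₀, hem₀'⟩ - (X * g₁) • ⟨(1 - idem K) • m₀, hem₀'⟩ +
        (X ^ 2 : K[X]) • ⟨(1 - idem K) • c₁, smul_mem_component _ hc₁⟩ : L₁).2
    erw [hgb₁, map_one, one_mul] at e1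
    erw [hgb₂, map_one, one_mul] at e2
    refine (congrArg₂ (· + ·) ((ρ₁.map_add _ _).trans (congrArg₂ (· + ·) e1 e3))
      ((ρ₂.map_add _ _).trans (congrArg₂ (· + ·) e4 e2))).trans ?_
    ring
  · -- The two values agree modulo `X`, so the pair of them lies in `R'`.
    have h := hsum v hv
    rw [← hα1, ← hβ1] at h
    obtain ⟨q, hq⟩ := Polynomial.exists_eq_X_mul_of_eval_zero
      (p := β ⟨_, smul_mem_component _ hv⟩ - α ⟨_, smul_mem_component _ hv⟩)
      (by rw [eval_sub, h, sub_self])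
    rw [hρ v hv, sub_eq_iff_eq_add.1 hq, Submodule.mem_span_singleton]
    refine ⟨algebraMap K[X] _ (α ⟨_, smul_mem_component _ hv⟩) +
      algebraMap K[X] _ q * AdjoinRoot.root _, ?_⟩
    rw [Algebra.smul_def, mul_one, map_add, map_mul, ← IsScalarTower.algebraMap_apply,
      ← IsScalarTower.algebraMap_apply, map_add, map_mul, algebraMap_X]
    change _ + _ * y K = _
    rw [← x_mul_idem]
    ring
  · have hvQ : v ∈ Q := hC.mem_of_le (by omega) hv
    have h2 : γ₂ ⟨_, smul_mem_component _ hvQ⟩ = 0 := hγ2 ⟨_, _⟩ (h1 v hv)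
    have h3 := (hsum v hvQ).trans h2
    rw [← hα1] at h3
    rw [← hβ1] at h2
    obtain ⟨p, hp⟩ := Polynomial.exists_eq_X_mul_of_eval_zero h3
    obtain ⟨q, hq⟩ := Polynomial.exists_eq_X_mul_of_eval_zero h2
    rw [hρ v hvQ, hp, hq, Submodule.mem_span_pair]
    refine ⟨algebraMap K[X] _ p, algebraMap K[X] _ q - algebraMap K[X] _ p, ?_⟩
    rw [Algebra.smul_def, Algebra.smul_def, map_sub, ← IsScalarTower.algebraMap_apply,
      ← IsScalarTower.algebraMap_apply, map_mul, map_mul, algebraMap_X, ← x_mul_idem]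
    ring

end IsLatticeChain

end Summands

/-! ### Summands belonging to sides and tagged arcs -/

section Decomposition

set_option linter.unusedSectionVars false

variable {K : Type*} [Field K] {V : Type*} [AddCommGroup V] [Module K[X] V] [Module (RPrime K) V]
  [Module (RPrimeInv K) V] [IsScalarTower K[X] (RPrimeInv K) V]
  [IsScalarTower (RPrime K) (RPrimeInv K) V] [IsScalarTower K[X] (RPrime K) V]

theorem smul_mem_of_mem_span {Q : Submodule (RPrime K) V} {S : Set (RPrimeInv K)} {m : V}
    (h : ∀ g ∈ S, g • m ∈ Q) {c : RPrimeInv K} (hc : c ∈ Submodule.span (RPrime K) S) :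
    c • m ∈ Q := by
  induction hc using Submodule.span_induction with
  | mem g hg => exact h g hg
  | zero => rw [zero_smul]; exact Q.zero_mem
  | add a b _ _ ha hb => rw [add_smul]; exact add_mem ha hb
  | smul a b _ hb => rw [smul_assoc]; exact Q.smul_mem a hb

theorem x_mul_mem_span_x {c : RPrimeInv K} (hc : c ∈ Submodule.span (RPrime K) {1}) :
    x K * c ∈ Submodule.span (RPrime K) {x K} :=
  mem_of_span (fun q hq => by
    rw [Set.mem_singleton_iff.1 hq, mul_one]
    exact Submodule.mem_span_singleton_self _) hc

theorem x_mul_mem_span_sq {c : RPrimeInv K} (hc : c ∈ Submodule.span (RPrime K) {x K, y K}) :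
    x K * c ∈ Submodule.span (RPrime K) {x K ^ 2, y K ^ 2} := by
  refine mem_of_span (fun q hq => ?_) hc
  rcases hq with rfl | hq
  · rw [← pow_two]
    exact Submodule.subset_span (by simp)
  · rw [Set.mem_singleton_iff.1 hq, ← y_mul_y, ← pow_two]
    exact Submodule.subset_span (by simp)

/-- The chain of `M_a` is a direct summand of the chain `C`: a vector `m` and a functional `ρ` such
that `v ↦ ρ v` and `c ↦ c • m` present `columnEntry a` as a retract of the terms `C i`, `0 ≤ i < n`.
If `a` ends in the puncture, then `ρ m` is an idempotent that acts on `columnEntry a` as `1`. -/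
def IsSummand {n : ℕ} (C : ℤ → Submodule (RPrime K) V) (a : Edge n) (m : V)
    (ρ : V →ₗ[RPrimeInv K] RPrimeInv K) : Prop :=
  ∀ i : Fin n, (∀ v ∈ C i, ρ v ∈ columnEntry (RPrime K) (x K) (y K) a i) ∧
    ∀ c ∈ columnEntry (RPrime K) (x K) (y K) a i, c • m ∈ C i ∧ c * ρ m = c

theorem columnEntry_plain {n : ℕ} (r i : Fin n) :
    columnEntry (RPrime K) (x K) (y K) (.plain r) i =
      if i ≤ r then Submodule.span (RPrime K) {x K * idem K}
      else Submodule.span (RPrime K) {x K * (x K * idem K)} := by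
  rw [x_mul_idem, ← y_mul_y, ← pow_two]
  rfl

theorem columnEntry_notched {n : ℕ} (r i : Fin n) :
    columnEntry (RPrime K) (x K) (y K) (.notched r) i =
      if i ≤ r then Submodule.span (RPrime K) {x K * (1 - idem K)}
      else Submodule.span (RPrime K) {x K * (x K * (1 - idem K))} := by
  have h1 : x K * (1 - idem K) = x K - y K := by rw [← x_mul_idem]; ring
  have h2 : x K * (x K * (1 - idem K)) = x K ^ 2 - y K ^ 2 := by
    rw [h1]
    linear_combination y_mul_y K
  rw [h2, h1]
  rfl

namespace IsLatticeChain

variable {n : ℕ} {C : ℤ → Submodule (RPrime K) V} (hC : IsLatticeChain n C)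
include hC

/-- The chain of `M_a` with `a = (P_r, P_s)` is split off by a pair `m`, `ρ` for which `m` lies in
the term `r` (shifted by a period if `s < r`) and `e m` in the term `s - n`. -/
theorem isSummand_seg {r s : Fin n} (hrs : r ≠ s) {j : ℤ}
    (hj : j = if r < s then (r : ℤ) else r - n) {m : V} {ρ : V →ₗ[RPrimeInv K] RPrimeInv K}
    (hm : m ∈ C j) (hm' : idem K • m ∈ C (s - n)) (hρ : ρ m = 1)
    (h1 : ∀ v ∈ C (s - n + 1), ρ v ∈ Submodule.span (RPrime K) {1})
    (h2 : ∀ v ∈ C (j + 1), ρ v ∈ Submodule.span (RPrime K) {x K, y K}) :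
    IsSummand C (.seg r s hrs) m ρ := by
  have hy : y K • m ∈ C s := by
    rw [← x_smul_idem_smul]
    exact hC.x_smul_mem_of_le (by omega) hm'
  intro i
  have hr := r.2
  have hs := s.2
  have hi := i.2
  have hx1 : ∀ v ∈ C i, (s : ℤ) - n + 1 ≤ i - n → ρ v ∈ Submodule.span (RPrime K) {x K} := by
    intro v hv hle
    obtain ⟨w, hw, rfl⟩ := hC.exists_eq_x_smul hv
    rw [map_smul, smul_eq_mul]
    exact x_mul_mem_span_x (h1 _ (hC.mem_of_le hle hw))
  have hne : (r : ℕ) ≠ s := fun h => hrs (Fin.ext h)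
  refine ⟨fun v hv => ?_, fun c hc => ⟨?_, by rw [hρ, mul_one]⟩⟩
  · simp only [columnEntry, Fin.le_def, Fin.lt_def] at hj ⊢
    split_ifs at hj ⊢ with c1 c2 c3 c2 c3
    · exact h1 _ (hC.mem_of_le (by omega) hv)
    · exact h2 _ (hC.mem_of_le (by omega) hv)
    · exact hx1 _ hv (by omega)
    · exact h2 _ (hC.mem_of_le (by omega) hv)
    · exact hx1 _ hv (by omega)
    · obtain ⟨w, hw, rfl⟩ := hC.exists_eq_x_smul hv
      rw [map_smul, smul_eq_mul]
      exact x_mul_mem_span_sq (h2 _ (hC.mem_of_le (by omega) hw))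
  · simp only [columnEntry, Fin.le_def, Fin.lt_def] at hj hc
    split_ifs at hj hc with c1 c2 c3 c2 c3 <;> refine smul_mem_of_mem_span ?_ hc <;>
      simp only [Set.mem_insert_iff, Set.mem_singleton_iff, forall_eq_or_imp, forall_eq, one_smul,
        pow_two, mul_smul]
    · exact hC.mem_of_le (by omega) hm
    · exact ⟨hC.x_smul_mem_of_le (by omega) hm, hC.mem_of_le (by omega) hy⟩
    · exact hC.x_smul_mem_of_le (by omega) hm
    · exact ⟨hC.x_smul_mem_of_le (by omega) hm, hC.mem_of_le (by omega) hy⟩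
    · exact hC.x_smul_mem_of_le (by omega) hm
    · refine ⟨hC.x_smul_mem_of_le (by omega) (hC.x_smul_mem_of_le (le_refl _) hm), ?_⟩
      rw [smul_smul, y_mul_y, mul_smul]
      exact hC.x_smul_mem_of_le (by omega) hy

/-- The chain of a module `M_a` of rank one, with coordinates `(X ε)` and then `(X² ε)`, is split
off by a pair `m`, `ρ` after rescaling by `X`. -/
theorem isSummand_of_rank_one {ε : RPrimeInv K} (hε : ε * ε = ε) {r : Fin n} {a : Edge n}
    (ha : ∀ i, columnEntry (RPrime K) (x K) (y K) a i =
      if i ≤ r then Submodule.span (RPrime K) {x K * ε}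
      else Submodule.span (RPrime K) {x K * (x K * ε)})
    {m : V} {ρ : V →ₗ[RPrimeInv K] RPrimeInv K}
    (hm : m ∈ C r) (hεm : ε • m = m) (hρ : ρ m = ε)
    (h : ∀ v ∈ C (r + 1 - n), ∃ f : K[X], ρ v = algebraMap K[X] _ f * ε) :
    IsSummand C a (xInv K • m) (x K • ρ) := by
  have hr := r.2
  have hx : xInv K * x K = 1 := by rw [mul_comm, x_mul_xInv]
  have h' : ∀ v ∈ C (r + 1 - n), x K * ρ v ∈ Submodule.span (RPrime K) {x K * ε} := by
    intro v hv
    obtain ⟨f, hf⟩ := h v hv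
    rw [hf, Submodule.mem_span_singleton]
    refine ⟨algebraMap K[X] _ f, ?_⟩
    rw [Algebra.smul_def, ← IsScalarTower.algebraMap_apply]
    ring
  intro i
  have hi := i.2
  rw [ha]
  refine ⟨fun v hv => ?_, fun c hc => ⟨?_, ?_⟩⟩
  · rw [LinearMap.smul_apply, smul_eq_mul]
    simp only [Fin.le_def]
    split_ifs with c1
    · exact h' v (hC.mem_of_le (by omega) hv)
    · obtain ⟨w, hw, rfl⟩ := hC.exists_eq_x_smul hv
      rw [map_smul, smul_eq_mul]
      refine mem_of_span (fun q hq => ?_) (h' w (hC.mem_of_le (by omega) hw))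
      rw [Set.mem_singleton_iff.1 hq]
      exact Submodule.mem_span_singleton_self _
  · simp only [Fin.le_def] at hc
    split_ifs at hc with c1 <;> refine smul_mem_of_mem_span ?_ hc <;>
      simp only [Set.mem_singleton_iff, forall_eq]
    · rw [smul_smul, mul_right_comm, mul_comm (x K), hx, one_mul, hεm]
      exact hC.mem_of_le (by omega) hm
    · rw [smul_smul, mul_right_comm, mul_comm (x K), hx, one_mul, mul_smul, hεm]
      exact hC.x_smul_mem_of_le (by omega) hm
  · rw [map_smul, LinearMap.smul_apply, hρ, smul_smul, hx, one_smul]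
    split_ifs at hc with c1
    all_goals
      obtain ⟨b, rfl⟩ := Submodule.mem_span_singleton.1 hc
      simp only [smul_mul_assoc, mul_assoc, hε]

variable [Module.IsTorsionFree K[X] V]

/-- A nonzero component preserved by the chain contains a jump of the chain. -/
theorem exists_jump {ε : RPrimeInv K} (hε : ε * ε = ε) (hεC : ∀ i, ∀ v ∈ C i, ε • v ∈ C i) {v : V}
    (hv : ε • v ≠ 0) : ∃ (r : Fin n) (m : V), m ∈ C r ∧ ε • m = m ∧ m ∉ C (r + 1) := by
  -- Without jumps, the component `L` of `C 0` satisfies `L = X L`, so it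
  -- vanishes by Nakayama's lemma.
  by_contra! h
  have hstep : ∀ k : ℕ, k ≤ n → ∀ m ∈ C 0, ε • m = m → m ∈ C k := by
    intro k
    induction k with
    | zero => intro _ m hm _; exact hm
    | succ k ih =>
      intro hk m hm hεm
      exact_mod_cast h ⟨k, hk⟩ m (ih (by omega) m hm hεm) hεm
  have := hC.finite 0
  have hfin := finite_component ε (C 0)
  have hmem : ∀ {l}, l ∈ component ε (C 0) ↔ l ∈ C 0 ∧ ε • l = l := by
    refine fun {l} => ⟨?_, fun hl => ⟨l, hl⟩⟩
    rintro ⟨q, hq, rfl⟩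
    refine ⟨hεC _ _ hq, ?_⟩
    change ε • ε • q = ε • q
    rw [smul_smul, hε]
  obtain ⟨p, hp1, hp2⟩ := Submodule.exists_sub_one_mem_and_smul_eq_zero_of_fg_of_le_smul
    (Ideal.span {(X : K[X])}) (component ε (C 0)) (Module.Finite.iff_fg.1 hfin) (by
      intro l hl
      obtain ⟨hl0, hεl⟩ := hmem.1 hl
      obtain ⟨w, hw, rfl⟩ := hC.exists_eq_x_smul (hstep n le_rfl l hl0 hεl)
      rw [x_smul_eq]
      refine Submodule.smul_mem_smul (Ideal.mem_span_singleton_self _) (hmem.2 ⟨?_, ?_⟩)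
      · simpa using hw
      · refine (isUnit_x K).smul_left_cancel.1 ?_
        rw [smul_comm, hεl])
  have hp : p ≠ 0 := by
    rintro rfl
    rw [zero_sub, Ideal.mem_span_singleton] at hp1
    exact not_isUnit_X (isUnit_of_dvd_unit hp1 isUnit_one.neg)
  obtain ⟨N, hN⟩ := hC.exists_x_pow_smul_mem 0 v
  have h0 := (smul_eq_zero.1 (hp2 _ (smul_mem_component ε hN))).resolve_left hp
  rw [smul_comm] at h0
  exact hv ((((isUnit_x K).pow N).smul_eq_zero).1 h0)

/-- Every nonzero lattice chain has a summand belonging to some side or tagged arc. -/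
theorem exists_isSummand (hn : 2 ≤ n) [Nontrivial V] :
    ∃ (a : Edge n) (m : V) (ρ : V →ₗ[RPrimeInv K] RPrimeInv K), IsSummand C a m ρ := by
  classical
  have hex : ∃ k : ℕ, ∀ i, ∀ v ∈ C i, idem K • v ∈ C (i - k) :=
    ⟨n, fun i v hv => hC.mem_of_le (by omega) (hC.idem_smul_mem hv)⟩
  -- The least shift of the chain that absorbs the denominators of the idempotent.
  obtain ⟨k, hk, hmin⟩ : ∃ k : ℕ, (∀ i, ∀ v ∈ C i, idem K • v ∈ C (i - k)) ∧
      ∀ k' < k, ¬ ∀ i, ∀ v ∈ C i, idem K • v ∈ C (i - k') :=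
    ⟨Nat.find hex, Nat.find_spec hex, fun k' h => Nat.find_min hex h⟩
  have hkn : k < n := by
    by_contra! h
    refine hmin (n - 1) (by omega) fun i v hv => hC.mem_of_le (by omega) (hC.idem_smul_mem hv)
  rcases Nat.eq_zero_or_pos k with rfl | hk0
  · have hk1 : ∀ i, ∀ v ∈ C i, idem K • v ∈ C i := fun i v hv => by simpa using hk i v hv
    have hk2 : ∀ i, ∀ v ∈ C i, (1 - idem K) • v ∈ C i := fun i v hv => by
      rw [sub_smul, one_smul]
      exact sub_mem hv (hk1 i v hv)
    obtain ⟨v, hv⟩ := exists_ne (0 : V)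
    by_cases hev : idem K • v = 0
    · have hev' : (1 - idem K) • v ≠ 0 := by rwa [sub_smul, one_smul, hev, sub_zero]
      obtain ⟨r, m₀, h1, h2, h3⟩ := hC.exists_jump (one_sub_idem_mul_self K) hk2 hev'
      obtain ⟨m, ρ, h4, h5, h6, h7⟩ := hC.exists_rank_one_summand (one_sub_idem_mul_self K)
        exists_x_pow_mul_mul_one_sub_idem hk2 (by omega) h1 h2 h3
      exact ⟨.notched r, _, _, hC.isSummand_of_rank_one (one_sub_idem_mul_self K)
        (columnEntry_notched r) h4 h5 h6 h7⟩
    · obtain ⟨r, m₀, h1, h2, h3⟩ := hC.exists_jump (idem_mul_idem K) hk1 hev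
      obtain ⟨m, ρ, h4, h5, h6, h7⟩ := hC.exists_rank_one_summand (idem_mul_idem K)
        exists_x_pow_mul_mul_idem hk1 (by omega) h1 h2 h3
      exact ⟨.plain r, _, _, hC.isSummand_of_rank_one (idem_mul_idem K)
        (columnEntry_plain r) h4 h5 h6 h7⟩
  · have h := hmin (k - 1) (by omega)
    push Not at h
    obtain ⟨j₀, m₁, hm₁, hem₁⟩ := h
    -- Rescaling by a power of `X` moves the position `j₀ - k` to the window `-n ≤ t < 0`.
    have hn0 : (0 : ℤ) < n := by omega
    obtain ⟨s, hs⟩ : ∃ s : Fin n, ((s : ℕ) : ℤ) = (j₀ - k) % n :=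
      ⟨⟨((j₀ - k) % n).toNat, by
        have := Int.emod_lt_of_pos (j₀ - k) hn0
        have := Int.emod_nonneg (j₀ - k) hn0.ne'
        omega⟩, Int.toNat_of_nonneg (Int.emod_nonneg (j₀ - k) hn0.ne')⟩
    obtain ⟨q, hq⟩ : ∃ q : ℤ, j₀ + n * q = s - n + k :=
      ⟨-((j₀ - k) / n) - 1, by
        have := Int.emod_add_mul_ediv (j₀ - k) n
        rw [mul_sub, mul_neg]
        omega⟩
    obtain ⟨u, hu⟩ := hC.exists_unit_smul_mem_iff q
    have hm₀ : u • m₁ ∈ C (s - n + k) := by rw [← hq, hu]; exact hm₁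
    have hem₀ : idem K • u • m₁ ∉ C (s - n + 1) := by
      rw [smul_comm, show (s : ℤ) - n + 1 = j₀ - ((k - 1 : ℕ) : ℤ) + n * q by omega, hu]
      exact hem₁
    obtain ⟨m, ρ, h1, h2, h3, h4, h5⟩ := hC.exists_rank_two_summand (t := s - n)
      (j := s - n + k) (by omega) (by omega) hm₀ hem₀
      (fun v hv => by have := hk _ v hv; rwa [add_sub_cancel_right] at this)
      (fun v hv => by
        have := hk _ v hv
        rwa [show (s : ℤ) - n + k + 1 - k = s - n + 1 by ring] at this)
    have hs2 := s.2
    by_cases hneg : (s : ℤ) - n + k < 0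
    · have hrs : (⟨s + k, by omega⟩ : Fin n) ≠ s := by
        rw [Ne, Fin.ext_iff]
        simp only
        omega
      refine ⟨.seg _ _ hrs, m, ρ, hC.isSummand_seg hrs (j := s - n + k) ?_ h1 h2 h3 h4 h5⟩
      rw [if_neg (by rw [Fin.lt_def]; simp only; omega)]
      simp only
      omega
    · have hrs : (⟨s + k - n, by omega⟩ : Fin n) ≠ s := by
        rw [Ne, Fin.ext_iff]
        simp only
        omega
      refine ⟨.seg _ _ hrs, m, ρ, hC.isSummand_seg hrs (j := s - n + k) ?_ h1 h2 h3 h4 h5⟩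
      rw [if_pos (by rw [Fin.lt_def]; simp only; omega)]
      simp only
      omega

end IsLatticeChain

end Decomposition

/-! ### Decomposition of lattice chains -/

section Induction

variable {K : Type*} [Field K]

theorem compX_x : compX (x K) = algebraMap K[X] _ X := by
  rw [← algebraMap_X, compX, laurentHom_algebraMap]

theorem compX_y : compX (y K) = algebraMap K[X] _ X := by
  rw [compX, laurentHom_y]

theorem compZero_x : compZero (x K) = algebraMap K[X] _ X := by
  rw [← algebraMap_X, compZero, laurentHom_algebraMap]

theorem compZero_y : compZero (y K) = 0 := by
  rw [compZero, laurentHom_y]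

theorem algebraMap_laurent_X_ne_zero : algebraMap K[X] (LaurentSeries K) X ≠ 0 := by
  rw [Ne, map_eq_zero_iff _ (FaithfulSMul.algebraMap_injective _ _)]
  exact X_ne_zero

variable (K) in
/-- An element of the first coordinates of `M_a` which acts on `M_a` as `X` does. -/
noncomputable def baseElement {n : ℕ} : Edge n → RPrimeInv K
  | .seg _ _ _ => x K
  | .plain _ => y K
  | .notched _ => x K - y K

theorem baseElement_mem_columnEntry {n : ℕ} (a : Edge n) {i : Fin n} (hi : (i : ℕ) = 0) :
    baseElement K a ∈ columnEntry (RPrime K) (x K) (y K) a i := by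
  rcases a with ⟨r, s, hrs⟩ | r | r
  · simp only [columnEntry, baseElement, Fin.le_def, hi, Nat.zero_le, if_true]
    split_ifs
    · rw [Submodule.mem_span_singleton]
      exact ⟨algebraMap K[X] _ X, by rw [Algebra.smul_def, mul_one]; rfl⟩
    · exact Submodule.subset_span (by simp)
  · simp only [columnEntry, baseElement, Fin.le_def, hi, Nat.zero_le, if_true]
    exact Submodule.mem_span_singleton_self _
  · simp only [columnEntry, baseElement, Fin.le_def, hi, Nat.zero_le, if_true]
    exact Submodule.mem_span_singleton_self _

theorem baseElement_ne_zero {n : ℕ} (a : Edge n) : baseElement K a ≠ 0 := by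
  intro h
  rcases a with ⟨r, s, hrs⟩ | r | r
  · have h' := congrArg compX h
    rw [baseElement, compX_x, map_zero] at h'
    exact algebraMap_laurent_X_ne_zero h'
  · have h' := congrArg compX h
    rw [baseElement, compX_y, map_zero] at h'
    exact algebraMap_laurent_X_ne_zero h'
  · have h' := congrArg compZero h
    rw [baseElement, map_sub, compZero_y, compZero_x, map_zero, sub_zero] at h'
    exact algebraMap_laurent_X_ne_zero h'

/-- Every lattice chain is a direct sum of chains belonging to sides and tagged arcs: an injective
map `φ` identifies each of its terms with a product of the lattices `columnEntry`. -/
theorem IsLatticeChain.exists_decomposition {n : ℕ} (hn : 2 ≤ n) (d : ℕ) :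
    ∀ {V : Type v} [AddCommGroup V] [Module K[X] V] [Module (RPrime K) V]
      [Module (RPrimeInv K) V] [IsScalarTower K[X] (RPrimeInv K) V]
      [IsScalarTower (RPrime K) (RPrimeInv K) V] [IsScalarTower K[X] (RPrime K) V]
      [Module.IsTorsionFree K[X] V] {C : ℤ → Submodule (RPrime K) V} (_ : IsLatticeChain n C)
      (_ : Module.finrank K[X] (C 0) = d),
      ∃ (m : ℕ) (a : Fin m → Edge n) (φ : V →ₗ[RPrimeInv K] (Fin m → RPrimeInv K)),
        Function.Injective φ ∧ ∀ i : Fin n,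
          (∀ v ∈ C i, ∀ k, φ v k ∈ columnEntry (RPrime K) (x K) (y K) (a k) i) ∧
          ∀ w : Fin m → RPrimeInv K, (∀ k, w k ∈ columnEntry (RPrime K) (x K) (y K) (a k) i) →
            ∃ v ∈ C i, φ v = w := by
  induction d using Nat.strong_induction_on with
  | _ d ih =>
  intro V _ _ _ _ _ _ _ _ C hC hd
  rcases subsingleton_or_nontrivial V with hV | hV
  · exact ⟨0, Fin.elim0, 0, fun _ _ _ => Subsingleton.elim _ _, fun i =>
      ⟨fun _ _ k => k.elim0, fun w _ => ⟨0, (C i).zero_mem, Subsingleton.elim _ _⟩⟩⟩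
  obtain ⟨a, m, ρ, hs⟩ := hC.exists_isSummand hn
  let i₀ : Fin n := ⟨0, by omega⟩
  -- `ρ m` need not be `1`, but it acts as `1` on the values of `ρ`.
  have hproj : ∀ v, ρ v * ρ m = ρ v := by
    intro v
    obtain ⟨N, hN⟩ := hC.exists_x_pow_smul_mem 0 v
    have h := ((hs i₀).2 _ ((hs i₀).1 _ hN)).2
    rw [map_smul, smul_eq_mul, mul_assoc] at h
    exact ((isUnit_x K).pow N).mul_left_cancel h
  let W := LinearMap.ker ρ
  let π : V →ₗ[RPrimeInv K] W :=
    LinearMap.codRestrict W (LinearMap.id - ρ.smulRight m) fun v => by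
      change ρ (v - ρ v • m) = 0
      rw [map_sub, map_smul, smul_eq_mul, hproj, sub_self]
  have hπ : ∀ v, ((π v : W) : V) = v - ρ v • m := fun v => rfl
  let D : ℤ → Submodule (RPrime K) W := fun i =>
    (C i).comap ((LinearMap.restrictScalars (RPrime K) W.subtype))
  have hmemD : ∀ i (w : W), w ∈ D i ↔ (w : V) ∈ C i := fun i w => Iff.rfl
  have hfinD : ∀ i, Module.Finite K[X] (D i) := by
    intro i
    have := hC.finite i
    let f : D i →ₗ[K[X]] C i :=
      { toFun := fun w => ⟨w.1.1, w.2⟩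
        map_add' := fun _ _ => rfl
        map_smul' := fun _ _ => rfl }
    refine Module.Finite.of_injective f fun w w' h => ?_
    exact Subtype.ext (Subtype.ext (congrArg (fun c : C i => (c : V)) h))
  have hD : IsLatticeChain n D :=
    { step := fun i w hw => hC.step i hw
      x_smul_mem_iff := fun i w => hC.x_smul_mem_iff i w.1
      y_smul_mem := fun i w hw => hC.y_smul_mem i w.1 hw
      finite := hfinD
      exists_x_pow_smul_mem := fun i w => hC.exists_x_pow_smul_mem i w.1 }
  have hrank : Module.finrank K[X] (D 0) < d := by
    have := hC.finite 0
    let g : C 0 →ₗ[K[X]] RPrimeInv K :=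
      (ρ.restrictScalars K[X]).comp ((C 0).restrictScalars K[X]).subtype
    have hrange : 0 < Module.finrank K[X] (C 0 ⧸ LinearMap.ker g) := by
      rw [g.quotKerEquivRange.finrank_eq]
      have hb := (hs i₀).2 _ (baseElement_mem_columnEntry (K := K) a rfl)
      have hg : g ⟨_, hb.1⟩ ≠ 0 := by
        change ρ (baseElement K a • m) ≠ 0
        rw [map_smul, smul_eq_mul, hb.2]
        exact baseElement_ne_zero a
      have : Nontrivial (LinearMap.range g) :=
        nontrivial_of_ne ⟨_, LinearMap.mem_range_self g _⟩ 0 fun h => hg (congrArg Subtype.val h)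
      exact Module.finrank_pos
    have hle : Module.finrank K[X] (D 0) ≤ Module.finrank K[X] (LinearMap.ker g) := by
      let f : D 0 →ₗ[K[X]] LinearMap.ker g :=
        { toFun := fun w => ⟨⟨w.1.1, w.2⟩, w.1.2⟩
          map_add' := fun _ _ => rfl
          map_smul' := fun _ _ => rfl }
      refine LinearMap.finrank_le_finrank_of_injective (f := f) fun w w' h => ?_
      exact Subtype.ext (Subtype.ext (congrArg (fun c : LinearMap.ker g => (c.1 : V)) h))
    have hsum := Submodule.finrank_quotient_add_finrank (LinearMap.ker g)
    omega
  obtain ⟨m', a', φ', hinj, hφ'⟩ := ih _ hrank hD rfl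
  refine ⟨m' + 1, Fin.cons a a', LinearMap.pi (Fin.cons ρ fun k => (LinearMap.proj k).comp
    (φ'.comp π)), ?_, fun i => ⟨fun v hv k => ?_, fun w hw => ?_⟩⟩
  · rw [← LinearMap.ker_eq_bot, LinearMap.ker_eq_bot']
    intro v hv
    have h0 : ρ v = 0 := congrFun hv 0
    have h1 : φ' (π v) = 0 := funext fun k => congrFun hv k.succ
    have h2 := congrArg Subtype.val (hinj (h1.trans (map_zero φ').symm))
    rwa [hπ, h0, zero_smul, sub_zero] at h2
  · have hvm : v - ρ v • m ∈ C i := sub_mem hv ((hs i).2 _ ((hs i).1 v hv)).1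
    refine Fin.cases ?_ (fun k => ?_) k
    · exact (hs i).1 v hv
    · exact (hφ' i).1 (π v) hvm k
  · obtain ⟨v, hv, hvw⟩ := (hφ' i).2 (fun k => w k.succ) fun k => hw k.succ
    have hw0 := (hs i).2 _ (hw 0)
    have hρv : ρ (v : V) = 0 := v.2
    have hρ : ρ (v + w 0 • m) = w 0 := by
      rw [map_add, hρv, zero_add, map_smul, smul_eq_mul]
      exact hw0.2
    refine ⟨v + w 0 • m, add_mem hv hw0.1, funext fun k => ?_⟩
    refine Fin.cases ?_ (fun k => ?_) k
    · exact hρ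
    · have : π (v + w 0 • m) = v := Subtype.ext (by rw [hπ, hρ, add_sub_cancel_right])
      change φ' (π (v + w 0 • m)) k = _
      rw [this, hvw]

end Induction

/-! ### Periodic extension of finite sequences of lattices -/

section PeriodicExtension

variable {K : Type*} [Field K] {V : Type*} [AddCommGroup V] [Module K[X] V] [Module (RPrime K) V]
  [Module (RPrimeInv K) V] [IsScalarTower K[X] (RPrimeInv K) V]
  [IsScalarTower (RPrime K) (RPrimeInv K) V] [IsScalarTower K[X] (RPrime K) V]

theorem ediv_emod_add_one {n : ℕ} (hn : 0 < n) (z : ℤ) :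
    (z % n + 1 < n ∧ (z + 1) % n = z % n + 1 ∧ (z + 1) / n = z / n) ∨
      (z % n + 1 = n ∧ (z + 1) % n = 0 ∧ (z + 1) / n = z / n + 1) := by
  have h0 : (0 : ℤ) < n := by omega
  have h1 := Int.emod_nonneg z h0.ne'
  have h2 := Int.emod_lt_of_pos z h0
  have h3 := Int.emod_add_mul_ediv z n
  rcases lt_or_eq_of_le (Int.add_one_le_of_lt h2) with h | h
  · have := (Int.ediv_emod_unique (a := z + 1) (r := z % n + 1) (q := z / n) h0).2
      ⟨by linarith, by omega, h⟩
    exact Or.inl ⟨h, this.2, this.1⟩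
  · have := (Int.ediv_emod_unique (a := z + 1) (r := 0) (q := z / n + 1) h0).2
      ⟨by rw [mul_add, mul_one]; linarith, le_rfl, h0⟩
    exact Or.inr ⟨h, this.2, this.1⟩

/-- A finite sequence of lattices that is stable under the generators of `Λ` extends periodically
to a lattice chain. -/
theorem exists_isLatticeChain {n : ℕ} (hn : 0 < n) (D : Fin n → Submodule (RPrime K) V)
    (hstep : ∀ i j : Fin n, (j : ℕ) = i + 1 → D j ≤ D i)
    (hx : ∀ i j : Fin n, (i : ℕ) = 0 → (j : ℕ) + 1 = n → ∀ v ∈ D i, x K • v ∈ D j)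
    (hy : ∀ i j : Fin n, (j : ℕ) = i + 1 → ∀ v ∈ D i, y K • v ∈ D j)
    (hxy : ∀ i j : Fin n, (i : ℕ) = 0 → (j : ℕ) + 1 = n → ∀ v ∈ D j, idem K • v ∈ D i)
    (hfin : ∀ i, Module.Finite K[X] (D i))
    (hspan : ∀ i v, ∃ N : ℕ, x K ^ N • v ∈ D i) :
    ∃ C : ℤ → Submodule (RPrime K) V, IsLatticeChain n C ∧ ∀ i : Fin n, C i = D i := by
  have h0 : (0 : ℤ) < n := by omega
  obtain ⟨u, hu⟩ := isUnit_x K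
  let idx : ℤ → Fin n := fun z => ⟨(z % n).toNat, by
    have := Int.emod_lt_of_pos z h0
    have := Int.emod_nonneg z h0.ne'
    omega⟩
  have hidx : ∀ z, ((idx z : ℕ) : ℤ) = z % n := fun z =>
    Int.toNat_of_nonneg (Int.emod_nonneg z h0.ne')
  let C : ℤ → Submodule (RPrime K) V := fun z =>
    (D (idx z)).comap (Algebra.lsmul (RPrime K) (RPrime K) V ((u ^ (-(z / n)) :
      (RPrimeInv K)ˣ) : RPrimeInv K))
  have hmem : ∀ z v, v ∈ C z ↔ u ^ (-(z / n)) • v ∈ D (idx z) := fun z v => Iff.rfl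
  have hux : ∀ v : V, x K • v = u • v := fun v => by rw [← hu]; rfl
  refine ⟨C, ⟨fun z v hv => ?_, fun z v => ?_, fun z v hv => ?_, fun z => ?_, fun z v => ?_⟩,
    fun i => ?_⟩
  · rw [hmem] at hv ⊢
    rcases ediv_emod_add_one hn z with ⟨h1, h2, h3⟩ | ⟨h1, h2, h3⟩
    · rw [h3] at hv
      exact hstep _ _ (by have := hidx z; have := hidx (z + 1); omega) hv
    · rw [h3] at hv
      have := hx (idx (z + 1)) (idx z) (by have := hidx (z + 1); omega)
        (by have := hidx z; omega) _ hv
      rwa [hux, smul_smul, ← zpow_one_add, show 1 + -(z / (n : ℤ) + 1) = -(z / n) by ring] at this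
  · have h1 : idx (z + n) = idx z := Fin.ext (by
      have h := Int.add_emod_right z n
      simp only [idx, h])
    rw [hmem, hmem, h1, Int.add_ediv_of_dvd_right (dvd_refl _), Int.ediv_self h0.ne', hux,
      smul_smul, ← zpow_add_one, show -(z / (n : ℤ) + 1) + 1 = -(z / n) by ring]
  · rw [hmem] at hv ⊢
    rw [smul_comm]
    rcases ediv_emod_add_one hn z with ⟨h1, h2, h3⟩ | ⟨h1, h2, h3⟩
    · rw [h3]
      exact hy _ _ (by have := hidx z; have := hidx (z + 1); omega) _ hv
    · rw [h3]
      have := hxy (idx (z + 1)) (idx z) (by have := hidx (z + 1); omega)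
        (by have := hidx z; omega) _ hv
      have e : u ^ (-(z / (n : ℤ) + 1)) • v = u⁻¹ • u ^ (-(z / (n : ℤ))) • v := by
        rw [smul_smul, ← zpow_neg_one, ← zpow_add]
        congr 2
        ring
      rw [e, ← x_mul_idem, mul_smul, smul_comm (idem K) u⁻¹, hux, smul_inv_smul]
      exact this
  · have := hfin (idx z)
    let f : C z →ₗ[K[X]] D (idx z) :=
      { toFun := fun v => ⟨u ^ (-(z / n)) • v.1, v.2⟩
        map_add' := fun v w => Subtype.ext (smul_add _ _ _)
        map_smul' := fun p v => Subtype.ext (smul_comm _ _ _) }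
    refine Module.Finite.of_injective f fun v w h => Subtype.ext ?_
    exact smul_left_cancel (u ^ (-(z / n))) (congrArg (fun c : D (idx z) => (c : V)) h)
  · obtain ⟨N, hN⟩ := hspan (idx z) (u ^ (-(z / n)) • v)
    refine ⟨N, ?_⟩
    rw [hmem, smul_comm]
    exact hN
  · have h1 : ((i : ℕ) : ℤ) / n = 0 := Int.ediv_eq_zero_of_lt (by omega) (by have := i.2; omega)
    have h2 : idx i = i := Fin.ext (by
      have h := Int.emod_eq_of_lt (a := ((i : ℕ) : ℤ)) (b := n) (by omega) (by have := i.2; omega)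
      have := hidx i
      omega)
    ext v
    rw [hmem, h1, h2, neg_zero, zpow_zero, one_smul]

end PeriodicExtension

/-! ### Localization at `X` -/

section Localization

variable {K : Type*} [Field K] (P : Type*) [AddCommGroup P] [Module (RPrime K) P]

variable (K) in
/-- The localization `P[X⁻¹]` of an `R'`-module `P`. -/
def LocalizedAtX : Type _ :=
  LocalizedModule (Submonoid.powers (algebraMap K[X] (RPrime K) X)) P

noncomputable instance : AddCommGroup (LocalizedAtX K P) :=
  inferInstanceAs (AddCommGroup (LocalizedModule _ P))

noncomputable instance : Module (RPrime K) (LocalizedAtX K P) :=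
  inferInstanceAs (Module (RPrime K) (LocalizedModule _ P))

noncomputable instance : Module (RPrimeInv K) (LocalizedAtX K P) :=
  inferInstanceAs (Module (Localization (Submonoid.powers (algebraMap K[X] (RPrime K) X)))
    (LocalizedModule (Submonoid.powers (algebraMap K[X] (RPrime K) X)) P))

instance : IsScalarTower (RPrime K) (RPrimeInv K) (LocalizedAtX K P) :=
  inferInstanceAs (IsScalarTower (RPrime K)
    (Localization (Submonoid.powers (algebraMap K[X] (RPrime K) X)))
    (LocalizedModule (Submonoid.powers (algebraMap K[X] (RPrime K) X)) P))

noncomputable instance : Module K[X] (LocalizedAtX K P) :=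
  Module.compHom _ (algebraMap K[X] (RPrimeInv K))

instance : IsScalarTower K[X] (RPrimeInv K) (LocalizedAtX K P) :=
  IsScalarTower.of_algebraMap_smul fun _ _ => rfl

instance : IsScalarTower K[X] (RPrime K) (LocalizedAtX K P) :=
  IsScalarTower.of_algebraMap_smul fun p v => by
    rw [← algebraMap_smul (RPrimeInv K), ← IsScalarTower.algebraMap_apply, algebraMap_smul]

/-- The canonical map `P → P[X⁻¹]`. -/
noncomputable def toLocalizedAtX : P →ₗ[RPrime K] LocalizedAtX K P :=
  LocalizedModule.mkLinearMap _ P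

instance : IsLocalizedModule (Submonoid.powers (algebraMap K[X] (RPrime K) X))
    (toLocalizedAtX (K := K) P) :=
  inferInstanceAs (IsLocalizedModule _ (LocalizedModule.mkLinearMap
    (Submonoid.powers (algebraMap K[X] (RPrime K) X)) P))

variable {P}

theorem exists_x_pow_smul_eq (v : LocalizedAtX K P) :
    ∃ (N : ℕ) (p : P), x K ^ N • v = toLocalizedAtX P p := by
  obtain ⟨⟨p, ⟨s, N, rfl⟩⟩, h⟩ := IsLocalizedModule.surj
    (Submonoid.powers (algebraMap K[X] (RPrime K) X)) (toLocalizedAtX P) v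
  refine ⟨N, p, ?_⟩
  rw [x, ← map_pow, algebraMap_smul]
  exact h

theorem toLocalizedAtX_injective
    (hP : ∀ p : P, algebraMap K[X] (RPrime K) X • p = 0 → p = 0) :
    Function.Injective (toLocalizedAtX (K := K) P) := by
  rw [← LinearMap.ker_eq_bot, LinearMap.ker_eq_bot']
  intro p hp
  obtain ⟨⟨s, N, rfl⟩, h⟩ := (IsLocalizedModule.eq_zero_iff
    (Submonoid.powers (algebraMap K[X] (RPrime K) X)) (toLocalizedAtX P)).1 hp
  change algebraMap K[X] (RPrime K) X ^ N • p = 0 at h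
  induction N with
  | zero => rwa [pow_zero, one_smul] at h
  | succ N ih =>
    rw [pow_succ', mul_smul] at h
    exact ih (hP _ h)

end Localization

/-! ### Elements of `Λ` -/

section OrderElements

variable {K : Type u} [Field K] {n : ℕ}

theorem algebraMap_mul_mem_orderEntry (a : RPrime K) {i j : Fin n} {b : RPrimeInv K}
    (hb : b ∈ orderEntry (RPrime K) (x K) (y K) (xInv K) i j) :
    algebraMap _ _ a * b ∈ orderEntry (RPrime K) (x K) (y K) (xInv K) i j := by
  rw [← Algebra.smul_def]
  exact Submodule.smul_mem _ a hb

theorem one_mem_orderEntry_of_le {i j : Fin n} (hij : i ≤ j) :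
    (1 : RPrimeInv K) ∈ orderEntry (RPrime K) (x K) (y K) (xInv K) i j := by
  unfold orderEntry
  split_ifs <;> exact Submodule.subset_span (by simp)

theorem x_mem_orderEntry (i j : Fin n) :
    x K ∈ orderEntry (RPrime K) (x K) (y K) (xInv K) i j := by
  unfold orderEntry
  split_ifs
  · exact mul_mem_span (c := x K) ⟨_, rfl⟩ (g := 1) (by simp) (mul_one _)
  · exact mul_mem_span (c := x K) ⟨_, rfl⟩ (g := 1) (by simp) (mul_one _)
  · exact Submodule.subset_span (by simp)
  · exact Submodule.subset_span (by simp)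

theorem y_mem_orderEntry {i j : Fin n} (hij : (i : ℕ) = j + 1) :
    y K ∈ orderEntry (RPrime K) (x K) (y K) (xInv K) i j := by
  unfold orderEntry
  rw [if_neg (by omega), if_neg (by rw [Fin.le_def]; omega), if_pos hij]
  exact Submodule.subset_span (by simp)

theorem idem_mem_orderEntry {i j : Fin n} (hi : (i : ℕ) = 0) (hj : (j : ℕ) + 1 = n) :
    idem K ∈ orderEntry (RPrime K) (x K) (y K) (xInv K) i j := by
  unfold orderEntry
  rw [if_pos ⟨hi, hj⟩]
  exact Submodule.subset_span (by simp [idem])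

theorem exists_x_mul_eq_algebraMap {i j : Fin n} {b : RPrimeInv K}
    (hb : b ∈ orderEntry (RPrime K) (x K) (y K) (xInv K) i j) :
    ∃ a : RPrime K, x K * b = algebraMap _ _ a := by
  suffices h : x K * b ∈ LinearMap.range (Algebra.linearMap (RPrime K) (RPrimeInv K)) by
    obtain ⟨a, ha⟩ := h
    exact ⟨a, ha.symm⟩
  unfold orderEntry at hb
  have hx : x K ∈ LinearMap.range (Algebra.linearMap (RPrime K) (RPrimeInv K)) := ⟨_, rfl⟩
  have hy : y K ∈ LinearMap.range (Algebra.linearMap (RPrime K) (RPrimeInv K)) := ⟨_, rfl⟩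
  have hxx : x K * x K ∈ LinearMap.range (Algebra.linearMap (RPrime K) (RPrimeInv K)) :=
    ⟨_, map_mul (algebraMap (RPrime K) (RPrimeInv K)) _ _⟩
  have hxy : x K * y K ∈ LinearMap.range (Algebra.linearMap (RPrime K) (RPrimeInv K)) :=
    ⟨_, map_mul (algebraMap (RPrime K) (RPrimeInv K)) _ _⟩
  split_ifs at hb <;> refine mem_of_span ?_ hb <;>
    simp only [Set.mem_insert_iff, Set.mem_singleton_iff, forall_eq_or_imp, forall_eq, mul_one,
      ← mul_assoc, x_mul_xInv, one_mul, and_self, hx, hy, hxx, hxy]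

/-- The element `b E_{ij}` of `Λ`. -/
noncomputable def matrixUnit (i j : Fin n) (b : RPrimeInv K)
    (hb : b ∈ orderEntry (RPrime K) (x K) (y K) (xInv K) i j) : LambdaOrder K n :=
  ⟨Matrix.single i j b, fun k l => by
    rw [Matrix.single_apply]
    split_ifs with h
    · rw [← h.1, ← h.2]
      exact hb
    · exact Submodule.zero_mem _⟩

variable (K n) in
/-- The embedding of `R'` into `Λ` as scalar matrices. -/
noncomputable def scalarHom : RPrime K →+* LambdaOrder K n :=
  RingHom.codRestrict ((algebraMap (RPrimeInv K) (Matrix (Fin n) (Fin n) (RPrimeInv K))).comp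
    (algebraMap (RPrime K) (RPrimeInv K))) (LambdaOrder K n) fun a i j => by
      rw [RingHom.comp_apply, Matrix.algebraMap_matrix_apply]
      split_ifs with h
      · subst h
        have := algebraMap_mul_mem_orderEntry a (one_mem_orderEntry_of_le (K := K) (le_refl i))
        rwa [mul_one] at this
      · exact Submodule.zero_mem _

theorem coe_scalarHom (a : RPrime K) : (scalarHom K n a : Matrix (Fin n) (Fin n) (RPrimeInv K)) =
    algebraMap _ _ (algebraMap (RPrime K) (RPrimeInv K) a) :=
  rfl

theorem scalarHom_algebraMap (p : K[X]) :
    scalarHom K n (algebraMap _ _ p) = algebraMap K[X] _ p := by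
  refine Subtype.ext ?_
  rw [coe_scalarHom, ← IsScalarTower.algebraMap_apply, ← IsScalarTower.algebraMap_apply]
  rfl

theorem scalarHom_comm (a : RPrime K) (A : LambdaOrder K n) :
    scalarHom K n a * A = A * scalarHom K n a :=
  Subtype.ext (Algebra.commutes _ _)

theorem matrixUnit_mul {i j k : Fin n} {b c : RPrimeInv K} (hb hc) :
    matrixUnit i j b hb * matrixUnit j k c hc =
      matrixUnit i k (b * c) (orderEntry_mul ⟨_, rfl⟩ ⟨_, rfl⟩ (x_mul_xInv K) (y_mul_y K) hb hc) :=
  Subtype.ext (Matrix.single_mul_single_same ..)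

theorem sum_matrixUnit_one :
    ∑ i : Fin n, matrixUnit i i (1 : RPrimeInv K) (one_mem_orderEntry_of_le le_rfl) = 1 := by
  refine Subtype.ext ?_
  rw [AddSubmonoidClass.coe_finsetSum]
  exact Matrix.sum_single_one

theorem scalarHom_mul_matrixUnit {i j : Fin n} {b : RPrimeInv K} (a : RPrime K) (hb) :
    scalarHom K n a * matrixUnit i j b hb =
      matrixUnit i j (algebraMap _ _ a * b) (algebraMap_mul_mem_orderEntry a hb) := by
  refine Subtype.ext ?_
  change algebraMap _ _ _ * Matrix.single i j b = Matrix.single i j _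
  rw [← Algebra.smul_def, Matrix.smul_single, Algebra.smul_def]

theorem matrixUnit_mul_mul {i j k l : Fin n} {b c : RPrimeInv K} (hb hc) (A : LambdaOrder K n) :
    ((matrixUnit i j b hb * A * matrixUnit k l c hc : LambdaOrder K n) :
      Matrix (Fin n) (Fin n) (RPrimeInv K)) = Matrix.single i l (b * A.1 j k * c) :=
  Matrix.single_mul_mul_single ..

theorem matrixUnit_congr {i j : Fin n} {b c : RPrimeInv K} {hb hc} (h : b = c) :
    matrixUnit i j b hb = matrixUnit i j c hc := by
  subst h
  rfl

end OrderElements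

/-! ### The lattice chain of a Cohen-Macaulay module -/

section LatticeModel

set_option linter.unusedSectionVars false

variable {K : Type u} [Field K] {n : ℕ} {M : Type v} [AddCommGroup M] [Module K[X] M]
  [Module (LambdaOrder K n) M] [IsScalarTower K[X] (LambdaOrder K n) M]
  [Module (RPrime K) M] (hM : ∀ (a : RPrime K) (m : M), a • m = scalarHom K n a • m)
  {o : Fin n}

include hM in
theorem isScalarTower_of_scalarHom : IsScalarTower K[X] (RPrime K) M :=
  IsScalarTower.of_algebraMap_smul fun p m => by
    rw [hM, scalarHom_algebraMap, algebraMap_smul]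

/-- The coordinates `E_{oo} M` of `M` at the index `o`, as an `R'`-module. Here `R'` acts on `M`
through its embedding into `Λ`, by the hypothesis `hM`. -/
def coordinates (o : Fin n) : Submodule (RPrime K) M where
  carrier := {m | matrixUnit o o (1 : RPrimeInv K) (one_mem_orderEntry_of_le le_rfl) • m = m}
  add_mem' {a b} ha hb := by
    rw [Set.mem_ofPred_eq] at *
    rw [smul_add, ha, hb]
  zero_mem' := smul_zero _
  smul_mem' a m hm := by
    rw [Set.mem_ofPred_eq] at *
    rw [hM, smul_smul, ← scalarHom_comm, mul_smul, hm]

theorem le_of_val_eq_zero (ho : (o : ℕ) = 0) (i : Fin n) : o ≤ i := by rw [Fin.le_def]; omega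

variable (ho : (o : ℕ) = 0)

/-- The map `m ↦ E_{oi} m`, where `o` is the first index. -/
noncomputable def rowMap (i : Fin n) : M →ₗ[RPrime K] coordinates hM o where
  toFun m := ⟨matrixUnit o i (1 : RPrimeInv K) (one_mem_orderEntry_of_le
    (le_of_val_eq_zero ho i)) • m, by
      change matrixUnit o o (1 : RPrimeInv K) _ • _ • _ = _
      rw [smul_smul, matrixUnit_mul]
      congr 1
      exact matrixUnit_congr (one_mul 1)⟩
  map_add' m m' := Subtype.ext (smul_add _ _ _)
  map_smul' a m := Subtype.ext (by
    change matrixUnit o i (1 : RPrimeInv K) _ • a • m =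
      a • matrixUnit o i (1 : RPrimeInv K) _ • m
    rw [hM, hM, smul_smul, smul_smul, scalarHom_comm])

/-- The map `m ↦ E_{oi} m` with values in the localization of `E_{oo} M`. -/
noncomputable def localRowMap (i : Fin n) :
    M →ₗ[RPrime K] LocalizedAtX K (coordinates hM o) :=
  (toLocalizedAtX _).comp (rowMap hM ho i)

/-- The maps `localRowMap` turn the action of `Λ` on `M` into multiplication of matrices with column
vectors over the localization. The entries of `A` need not lie in `R'`, but `X` times them do. -/
theorem localRowMap_smul (A : LambdaOrder K n) (m : M) (i : Fin n) :
    localRowMap hM ho i (A • m) = ∑ j, A.1 i j • localRowMap hM ho j m := by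
  have h1 : A • m = ∑ j, (A * matrixUnit j j (1 : RPrimeInv K)
      (one_mem_orderEntry_of_le le_rfl)) • m := by
    rw [← Finset.sum_smul, ← Finset.mul_sum, sum_matrixUnit_one, mul_one]
  rw [h1, map_sum]
  refine Finset.sum_congr rfl fun j _ => ?_
  obtain ⟨a, ha⟩ := exists_x_mul_eq_algebraMap (A.2 i j)
  refine (isUnit_x K).smul_left_cancel.1 ?_
  rw [smul_smul, ha, algebraMap_smul, x, algebraMap_smul, ← map_smul, ← map_smul]
  refine congrArg (toLocalizedAtX _) (Subtype.ext ?_)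
  change matrixUnit o i (1 : RPrimeInv K) _ • (algebraMap K[X] (RPrime K) X) • _ =
    matrixUnit o j (1 : RPrimeInv K) _ • a • m
  rw [hM, hM, smul_smul, smul_smul, smul_smul]
  congr 1
  rw [← mul_assoc, ← scalarHom_comm, ← scalarHom_comm, mul_assoc, ← mul_assoc _ A]
  refine Subtype.ext ?_
  rw [scalarHom_mul_matrixUnit, scalarHom_mul_matrixUnit, matrixUnit_mul_mul]
  change Matrix.single o j _ = Matrix.single o j _
  rw [mul_one, mul_one, mul_one, ← ha]
  rfl

theorem smul_localRowMap {i j : Fin n} {b : RPrimeInv K} (hb) (m : M) :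
    b • localRowMap hM ho j m = localRowMap hM ho i (matrixUnit i j b hb • m) := by
  rw [localRowMap_smul, Finset.sum_eq_single j]
  · change _ = Matrix.single i j b i j • _
    rw [Matrix.single_apply_same]
  · intro k _ hk
    change Matrix.single i j b i k • _ = _
    rw [Matrix.single_apply_of_col_ne _ _ hk.symm, zero_smul]
  · exact fun h => absurd (Finset.mem_univ j) h

theorem localRowMap_sum_matrixUnit_smul (w : Fin n → M) (i : Fin n) :
    localRowMap hM ho i (∑ j, matrixUnit j j (1 : RPrimeInv K)
      (one_mem_orderEntry_of_le le_rfl) • w j) = localRowMap hM ho i (w i) := by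
  rw [map_sum, Finset.sum_eq_single i]
  · rw [← smul_localRowMap, one_smul]
  · intro k _ hk
    rw [localRowMap_smul]
    refine Finset.sum_eq_zero fun l _ => ?_
    change Matrix.single k k (1 : RPrimeInv K) i l • _ = _
    rw [Matrix.single_apply_of_row_ne hk, zero_smul]
  · exact fun h => absurd (Finset.mem_univ i) h

include hM in
theorem algebraMap_X_smul_eq_zero [Module.IsTorsionFree K[X] M] {m : M}
    (h : algebraMap K[X] (RPrime K) X • m = 0) : m = 0 := by
  rw [hM, scalarHom_algebraMap, algebraMap_smul] at h
  exact (smul_eq_zero.1 h).resolve_left X_ne_zero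

theorem toLocalizedAtX_coordinates_injective [Module.IsTorsionFree K[X] M] :
    Function.Injective (toLocalizedAtX (K := K) (coordinates hM o)) :=
  toLocalizedAtX_injective fun _ hp =>
    Subtype.ext (algebraMap_X_smul_eq_zero hM (congrArg Subtype.val hp))

theorem eq_zero_of_localRowMap_eq_zero [Module.IsTorsionFree K[X] M] {m : M}
    (h : ∀ i, localRowMap hM ho i m = 0) : m = 0 := by
  have h1 : ∀ i, matrixUnit o i (1 : RPrimeInv K) (one_mem_orderEntry_of_le
      (le_of_val_eq_zero ho i)) • m = 0 := fun i =>
    congrArg Subtype.val (toLocalizedAtX_coordinates_injective hM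
      ((h i).trans (map_zero (toLocalizedAtX (K := K) (coordinates hM o))).symm))
  refine algebraMap_X_smul_eq_zero hM ?_
  rw [hM, ← mul_one (scalarHom K n _), ← sum_matrixUnit_one, Finset.mul_sum, Finset.sum_smul]
  refine Finset.sum_eq_zero fun i _ => ?_
  have h2 : scalarHom K n (algebraMap K[X] (RPrime K) X) *
      matrixUnit i i (1 : RPrimeInv K) (one_mem_orderEntry_of_le le_rfl) =
      matrixUnit i o (x K) (x_mem_orderEntry i o) * matrixUnit o i (1 : RPrimeInv K)
        (one_mem_orderEntry_of_le (le_of_val_eq_zero ho i)) := by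
    rw [scalarHom_mul_matrixUnit, matrixUnit_mul]
    rfl
  rw [h2, mul_smul, h1, smul_zero]

include hM in
theorem isTorsionFree_localizedAtX [Module.IsTorsionFree K[X] M] :
    Module.IsTorsionFree K[X] (LocalizedAtX K (coordinates hM o)) := by
  have := isScalarTower_of_scalarHom hM
  refine Module.IsTorsionFree.of_smul_eq_zero fun p v h => ?_
  by_cases hp : p = 0
  · exact Or.inl hp
  obtain ⟨N, q, hq⟩ := exists_x_pow_smul_eq v
  have h1 : toLocalizedAtX (K := K) (coordinates hM o) (p • q) = 0 := by
    rw [← algebraMap_smul (RPrime K), map_smul, ← hq, algebraMap_smul, smul_comm, h, smul_zero]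
  have h2 : p • q = 0 := toLocalizedAtX_coordinates_injective hM (h1.trans (map_zero _).symm)
  rw [(smul_eq_zero.1 h2).resolve_left hp, map_zero] at hq
  exact Or.inr ((((isUnit_x K).pow N).smul_eq_zero).1 hq)

/-- The lattices of `i`-th coordinates of a Cohen-Macaulay module form a lattice chain. -/
theorem exists_isLatticeChain_range (hn : 2 ≤ n) [Module.IsTorsionFree K[X] M]
    [Module.Finite K[X] M] :
    ∃ C : ℤ → Submodule (RPrime K) (LocalizedAtX K (coordinates hM o)), IsLatticeChain n C ∧
      ∀ i : Fin n, C i = LinearMap.range (localRowMap hM ho i) := by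
  have := isScalarTower_of_scalarHom hM
  have hmem : ∀ {i j : Fin n} {b : RPrimeInv K},
      b ∈ orderEntry (RPrime K) (x K) (y K) (xInv K) i j →
      ∀ v ∈ LinearMap.range (localRowMap hM ho j),
        b • v ∈ LinearMap.range (localRowMap hM ho i) := by
    rintro i j b hb _ ⟨m, rfl⟩
    exact ⟨_, (smul_localRowMap hM ho hb m).symm⟩
  refine exists_isLatticeChain (by omega) (fun i => LinearMap.range (localRowMap hM ho i))
    (fun i j hij v hv => ?_) (fun i j _ _ v hv => hmem (x_mem_orderEntry _ _) v hv)
    (fun i j hij v hv => hmem (y_mem_orderEntry hij) v hv)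
    (fun i j hi hj v hv => hmem (idem_mem_orderEntry hi hj) v hv) (fun i => ?_) (fun i v => ?_)
  · have := hmem (one_mem_orderEntry_of_le (i := i) (j := j) (by rw [Fin.le_def]; omega)) v hv
    rwa [one_smul] at this
  · have h : LinearMap.range ((localRowMap hM ho i).restrictScalars K[X]) =
        (LinearMap.range (localRowMap hM ho i)).restrictScalars K[X] := rfl
    have : Module.Finite K[X] (LinearMap.range ((localRowMap hM ho i).restrictScalars K[X])) :=
      inferInstance
    rw [h] at this
    exact this
  · obtain ⟨N, p, hp⟩ := exists_x_pow_smul_eq v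
    refine ⟨N + 1, ?_⟩
    rw [pow_succ', mul_smul, hp]
    refine hmem (x_mem_orderEntry i o) _ ⟨p, ?_⟩
    exact congrArg (toLocalizedAtX _) (Subtype.ext p.2)

end LatticeModel

/-- A Cohen-Macaulay module is a finite direct sum of modules `M_a`. -/
theorem exists_linearEquiv_pi_columnModule {K : Type u} [Field K] {n : ℕ} (hn : 2 ≤ n) (M : Type v)
    [AddCommGroup M] [Module K[X] M] [Module (LambdaOrder K n) M]
    [IsScalarTower K[X] (LambdaOrder K n) M] (hCM : IsCMModule K[X] (LambdaOrder K n) M) :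
    ∃ (m : ℕ) (a : Fin m → Edge n),
      Nonempty (M ≃ₗ[LambdaOrder K n] ((k : Fin m) → columnModule K (a k))) := by
  have hfin := hCM.1
  have htf := moduleSocle_eq_bot_iff_isTorsionFree.1 hCM.2
  let _ : Module (RPrime K) M := Module.compHom M (scalarHom K n)
  have hM : ∀ (a : RPrime K) (m : M), a • m = scalarHom K n a • m := fun _ _ => rfl
  let o : Fin n := ⟨0, by omega⟩
  have ho : (o : ℕ) = 0 := rfl
  obtain ⟨C, hC, hCi⟩ := exists_isLatticeChain_range hM ho hn
  have := isTorsionFree_localizedAtX (o := o) hM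
  obtain ⟨m, a, φ, hφ, hφC⟩ := IsLatticeChain.exists_decomposition hn _ hC rfl
  have hmem : ∀ (i : Fin n) (w : M), localRowMap hM ho i w ∈ C i := fun i w => by
    rw [hCi]
    exact ⟨w, rfl⟩
  let F : M →ₗ[LambdaOrder K n] ((k : Fin m) → columnModule K (a k)) :=
    { toFun := fun w k => ⟨fun i => φ (localRowMap hM ho i w) k, fun i => (hφC i).1 _ (hmem i w) k⟩
      map_add' := fun v w => funext fun k => Subtype.ext (funext fun i => by
        change φ (localRowMap hM ho i (v + w)) k = φ _ k + φ _ k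
        rw [map_add, map_add, Pi.add_apply])
      map_smul' := fun A w => funext fun k => Subtype.ext (funext fun i => by
        change φ (localRowMap hM ho i (A • w)) k = ∑ j, A.1 i j * φ (localRowMap hM ho j w) k
        rw [localRowMap_smul, map_sum, Finset.sum_apply]
        refine Finset.sum_congr rfl fun j _ => ?_
        rw [map_smul]
        rfl) }
  have hF : ∀ w k i, (F w k).1 i = φ (localRowMap hM ho i w) k := fun _ _ _ => rfl
  refine ⟨m, a, ⟨LinearEquiv.ofBijective F ⟨?_, fun w => ?_⟩⟩⟩
  · refine (injective_iff_map_eq_zero F).2 fun w hw => ?_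
    refine eq_zero_of_localRowMap_eq_zero hM ho fun i => hφ ?_
    rw [map_zero]
    funext k
    rw [← hF, hw]
    rfl
  · have h : ∀ i : Fin n, ∃ m : M, φ (localRowMap hM ho i m) = fun k => (w k).1 i := by
      intro i
      obtain ⟨v, hv, hvw⟩ := (hφC i).2 (fun k => (w k).1 i) fun k => (w k).2 i
      rw [hCi] at hv
      obtain ⟨m, rfl⟩ := hv
      exact ⟨m, hvw⟩
    choose g hg using h
    refine ⟨∑ j, matrixUnit j j (1 : RPrimeInv K) (one_mem_orderEntry_of_le le_rfl) • g j,
      funext fun k => Subtype.ext (funext fun i => ?_)⟩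
    rw [hF, localRowMap_sum_matrixUnit_smul, hg]

end PuncturedPolygon

/-! ### Orders of Laurent series -/

section LaurentOrder

variable {K : Type*} [Field K]

theorem order_algebraMap_X : (algebraMap K[X] (LaurentSeries K) X).order = 1 := by
  have h : algebraMap K[X] (LaurentSeries K) X = HahnSeries.single 1 1 := by
    change HahnSeries.ofPowerSeries ℤ K ((X : K[X]) : PowerSeries K) = _
    rw [Polynomial.coe_X, HahnSeries.ofPowerSeries_X]
  rw [h, HahnSeries.order_single one_ne_zero]

theorem order_algebraMap_nonneg (p : K[X]) : 0 ≤ (algebraMap K[X] (LaurentSeries K) p).order := by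
  by_contra! h
  have h0 : algebraMap K[X] (LaurentSeries K) p ≠ 0 := by
    intro h0
    rw [h0, HahnSeries.order_zero] at h
    exact lt_irrefl _ h
  refine (mt HahnSeries.coeff_order_eq_zero.1 h0) ?_
  change (HahnSeries.ofPowerSeries ℤ K (p : PowerSeries K)).coeff _ = 0
  rw [PowerSeries.coeff_coe, if_pos h]

theorem LaurentSeries.coeff_zero_mul {z w : LaurentSeries K} (hz : 0 ≤ z.order)
    (hw : 0 ≤ w.order) : (z * w).coeff 0 = z.coeff 0 * w.coeff 0 := by
  by_cases hz0 : z = 0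
  · simp [hz0]
  by_cases hw0 : w = 0
  · simp [hw0]
  rcases hz.eq_or_lt with hz | hz
  · rcases hw.eq_or_lt with hw | hw
    · have h := HahnSeries.coeff_mul_order_add_order z w
      rwa [HahnSeries.leadingCoeff_eq, HahnSeries.leadingCoeff_eq, ← hz, ← hw, add_zero] at h
    · rw [HahnSeries.coeff_eq_zero_of_lt_order hw, mul_zero]
      exact HahnSeries.coeff_eq_zero_of_lt_order (by rw [HahnSeries.order_mul hz0 hw0]; omega)
  · rw [HahnSeries.coeff_eq_zero_of_lt_order hz, zero_mul]
    exact HahnSeries.coeff_eq_zero_of_lt_order (by rw [HahnSeries.order_mul hz0 hw0]; omega)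

end LaurentOrder

namespace PuncturedPolygon

/-! ### Exponents of the coordinates of `M_a` -/

section Exponents

variable {K : Type*} [Field K] {n : ℕ}

/-- The two components of `R'[X⁻¹]`: `true` stands for `Y = X` and `false` for `Y = 0`. -/
noncomputable def comp (t : Bool) : RPrimeInv K →+* LaurentSeries K := if t then compX else compZero

theorem comp_algebraMap (t : Bool) (p : K[X]) :
    comp t (algebraMap K[X] (RPrimeInv K) p) = algebraMap K[X] _ p := by
  cases t
  · exact laurentHom_algebraMap 0 (by simp) p
  · exact laurentHom_algebraMap (algebraMap K[X] (LaurentSeries K) X) (by simp) p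

theorem comp_x (t : Bool) : comp t (x K) = algebraMap K[X] _ X := by
  rw [← algebraMap_X, comp_algebraMap]

theorem comp_true_y : comp true (y K) = algebraMap K[X] _ X := compX_y

theorem comp_false_y : comp false (y K) = 0 := compZero_y

theorem eq_zero_of_forall_comp_eq_zero {t : Bool} {b : RPrimeInv K} (h : comp t b = 0)
    (h' : comp (!t) b = 0) : b = 0 := by
  cases t
  · exact eq_zero_of_comp_eq_zero h h'
  · exact eq_zero_of_comp_eq_zero h' h

theorem exists_comp_algebraMap_eq (t : Bool) (a : RPrime K) :
    ∃ p : K[X], comp t (algebraMap (RPrime K) (RPrimeInv K) a) = algebraMap K[X] _ p := by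
  obtain ⟨f, g, h⟩ := rPrime_exists_eq a
  cases t
  · exact ⟨f, by rw [h, map_add, map_mul, comp_false_y, mul_zero, add_zero, comp_algebraMap]⟩
  · exact ⟨f + g * X, by
      rw [h, map_add, map_mul, comp_true_y, comp_algebraMap, comp_algebraMap, map_add, map_mul]⟩

variable (K) in
/-- The element of `R'` which is `X` in the component `t` and `0` in the other one. -/
noncomputable def compElement (t : Bool) : RPrimeInv K := if t then y K else x K - y K

theorem comp_compElement (t : Bool) : comp t (compElement K t) = algebraMap K[X] _ X := by
  cases t
  · change comp false (x K - y K) = _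
    rw [map_sub, comp_x, comp_false_y, sub_zero]
  · exact comp_true_y

theorem comp_not_compElement (t : Bool) : comp (!t) (compElement K t) = 0 := by
  cases t
  · change comp true (x K - y K) = 0
    rw [map_sub, comp_x, comp_true_y, sub_self]
  · exact comp_false_y

variable (K) in
/-- The elements of `R'[X⁻¹]` whose component `t` lies in `X ^ k K[X]`. -/
noncomputable def compLattice (t : Bool) (k : ℕ) : Submodule (RPrime K) (RPrimeInv K) where
  carrier := {w | ∃ p : K[X], comp t w = algebraMap K[X] _ (X ^ k * p)}
  add_mem' := by
    rintro v w ⟨p, hp⟩ ⟨q, hq⟩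
    exact ⟨p + q, by rw [map_add, hp, hq, mul_add, map_add]⟩
  zero_mem' := ⟨0, by simp⟩
  smul_mem' := by
    rintro a w ⟨p, hp⟩
    obtain ⟨q, hq⟩ := exists_comp_algebraMap_eq t a
    exact ⟨q * p, by rw [Algebra.smul_def, map_mul, hp, hq, ← map_mul, mul_left_comm]⟩

theorem one_mem_compLattice (t : Bool) : 1 ∈ compLattice K t 0 := ⟨1, by simp⟩

theorem x_mul_mem_compLattice {t : Bool} {k : ℕ} {w : RPrimeInv K} (hw : w ∈ compLattice K t k) :
    x K * w ∈ compLattice K t (k + 1) := by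
  obtain ⟨p, hp⟩ := hw
  exact ⟨p, by rw [map_mul, hp, comp_x, ← map_mul]; congr 1; ring⟩

theorem y_mul_mem_compLattice {t : Bool} {k : ℕ} {w : RPrimeInv K} (hw : w ∈ compLattice K t k) :
    y K * w ∈ compLattice K t (k + 1) := by
  cases t
  · exact ⟨0, by rw [map_mul, comp_false_y]; simp⟩
  · obtain ⟨p, hp⟩ := hw
    exact ⟨p, by rw [map_mul, hp, comp_true_y, ← map_mul]; congr 1; ring⟩

theorem order_comp_of_mem_compLattice {t : Bool} {k : ℕ} {w : RPrimeInv K}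
    (hw : w ∈ compLattice K t k) (h0 : comp t w ≠ 0) : (k : ℤ) ≤ (comp t w).order := by
  obtain ⟨p, hp⟩ := hw
  rw [map_mul, map_pow] at hp
  rw [hp] at h0 ⊢
  rw [HahnSeries.order_mul (left_ne_zero_of_mul h0) (right_ne_zero_of_mul h0),
    HahnSeries.order_pow, order_algebraMap_X]
  have := order_algebraMap_nonneg p
  simp only [nsmul_eq_mul, mul_one]
  omega

/-- The first endpoint of a side or arc; the marked vertex if the arc ends in the puncture. -/
def Edge.source : Edge n → Fin n
  | .seg r _ _ => r
  | .plain r => r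
  | .notched r => r

/-- The second endpoint of a side or arc; the marked vertex if the arc ends in the puncture. -/
def Edge.target : Edge n → Fin n
  | .seg _ s _ => s
  | .plain r => r
  | .notched r => r

/-- The components of `R'[X⁻¹]` on which `M_a` is not zero. -/
def Edge.Alive : Edge n → Bool → Prop
  | .seg _ _ _, _ => True
  | .plain _, t => t = true
  | .notched _, t => t = false

/-- The exponent of `X` in the projection of the `i`-th coordinates of `M_a` to a component. -/
def outerExp (a : Edge n) (i : Fin n) : ℕ :=
  (if a.source < a.target then 0 else 1) + if i ≤ a.source then 0 else 1

/-- The exponent of `X` in the intersection of the `i`-th coordinates of `M_a` with a component. -/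
def innerExp (a : Edge n) (i : Fin n) : ℕ :=
  1 + if i ≤ a.target then 0 else 1

theorem outerExp_seg (r s i : Fin n) (hrs : r ≠ s) : outerExp (.seg r s hrs) i =
    (if r < s then 0 else 1) + if i ≤ r then 0 else 1 :=
  rfl

theorem outerExp_plain (r i : Fin n) : outerExp (.plain r) i = 1 + if i ≤ r then 0 else 1 := by
  change (if r < r then 0 else 1) + (if i ≤ r then 0 else 1) = _
  rw [if_neg (lt_irrefl r)]

theorem outerExp_notched (r i : Fin n) : outerExp (.notched r) i = 1 + if i ≤ r then 0 else 1 :=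
  outerExp_plain r i

theorem innerExp_seg (r s i : Fin n) (hrs : r ≠ s) : innerExp (.seg r s hrs) i =
    1 + if i ≤ s then 0 else 1 :=
  rfl

theorem innerExp_plain (r i : Fin n) : innerExp (.plain r) i = 1 + if i ≤ r then 0 else 1 :=
  rfl

theorem innerExp_notched (r i : Fin n) : innerExp (.notched r) i = 1 + if i ≤ r then 0 else 1 :=
  rfl

/-- The exponents of its coordinates in a common component determine a side or tagged arc. -/
theorem Edge.eq_of_exp_eq {a b : Edge n} {t : Bool} (ha : a.Alive t) (hb : b.Alive t)
    (ho : ∀ i, outerExp a i = outerExp b i) (hi : ∀ i, innerExp a i = innerExp b i) : a = b := by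
  have htgt : a.target = b.target := by
    have h1 := hi a.target
    have h2 := hi b.target
    simp only [innerExp, le_refl, if_true] at h1 h2
    refine le_antisymm ?_ ?_
    · by_contra h
      rw [if_neg h] at h1
      omega
    · by_contra h
      rw [if_neg h] at h2
      omega
  have hlt : a.source < a.target ↔ b.source < b.target := by
    have h0 : 0 < n := a.target.pos
    have h := ho ⟨0, h0⟩
    have hle : ∀ j : Fin n, (⟨0, h0⟩ : Fin n) ≤ j := fun j => Nat.zero_le _
    simp only [outerExp, hle, if_true] at h
    split_ifs at h with h1 h2 h2
    · exact iff_of_true h1 h2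
    · omega
    · omega
    · exact iff_of_false h1 h2
  have hsrc : a.source = b.source := by
    have h1 := ho a.source
    have h2 := ho b.source
    simp only [outerExp, hlt, le_refl, if_true] at h1 h2
    refine le_antisymm ?_ ?_
    · by_contra h
      rw [if_neg h] at h1
      omega
    · by_contra h
      rw [if_neg h] at h2
      omega
  clear ho hi hlt
  rcases a with ⟨r, s, hrs⟩ | r | r <;> rcases b with ⟨r', s', hrs'⟩ | r' | r' <;>
    simp only [Edge.source, Edge.target] at htgt hsrc
  · subst htgt hsrc
    rfl
  · exact absurd (hsrc.trans htgt.symm) hrs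
  · exact absurd (hsrc.trans htgt.symm) hrs
  · exact absurd (hsrc.symm.trans htgt) hrs'
  · rw [hsrc]
  · exact absurd (ha.symm.trans hb) (by decide)
  · exact absurd (hsrc.symm.trans htgt) hrs'
  · exact absurd (ha.symm.trans hb) (by decide)
  · rw [hsrc]

theorem span_le_compLattice (t : Bool) :
    Submodule.span (RPrime K) {1} ≤ compLattice K t 0 ∧
    Submodule.span (RPrime K) {x K, y K} ≤ compLattice K t 1 ∧
    Submodule.span (RPrime K) {x K} ≤ compLattice K t 1 ∧
    Submodule.span (RPrime K) {x K ^ 2, y K ^ 2} ≤ compLattice K t 2 ∧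
    Submodule.span (RPrime K) {y K} ≤ compLattice K t 1 ∧
    Submodule.span (RPrime K) {y K ^ 2} ≤ compLattice K t 2 ∧
    Submodule.span (RPrime K) {x K - y K} ≤ compLattice K t 1 ∧
    Submodule.span (RPrime K) {x K ^ 2 - y K ^ 2} ≤ compLattice K t 2 := by
  have h1 := one_mem_compLattice (K := K) t
  have hx : x K ∈ compLattice K t 1 := by simpa using x_mul_mem_compLattice h1
  have hy : y K ∈ compLattice K t 1 := by simpa using y_mul_mem_compLattice h1
  have hxx : x K ^ 2 ∈ compLattice K t 2 := by rw [pow_two]; exact x_mul_mem_compLattice hx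
  have hyy : y K ^ 2 ∈ compLattice K t 2 := by rw [pow_two]; exact y_mul_mem_compLattice hy
  simp only [Submodule.span_le, Set.insert_subset_iff, Set.singleton_subset_iff, SetLike.mem_coe,
    h1, hx, hy, hxx, hyy, sub_mem hx hy, sub_mem hxx hyy, and_self]

theorem columnEntry_le_compLattice (a : Edge n) (i : Fin n) (t : Bool) :
    columnEntry (RPrime K) (x K) (y K) a i ≤ compLattice K t (outerExp a i) := by
  obtain ⟨h1, h2, h3, h4, h5, h6, h7, h8⟩ := span_le_compLattice (K := K) t
  rcases a with ⟨r, s, hrs⟩ | r | r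
  · have hne : (r : ℕ) ≠ s := fun h => hrs (Fin.ext h)
    simp only [columnEntry, outerExp_seg, Fin.le_def, Fin.lt_def]
    split_ifs <;> first | assumption | (exfalso; omega)
  · simp only [columnEntry, outerExp_plain]
    split_ifs <;> assumption
  · simp only [columnEntry, outerExp_notched]
    split_ifs <;> assumption

/-- An element of `R'` that vanishes in one component is divisible by `X` in the other one. -/
theorem mem_compLattice_one_of_comp_eq_zero {t : Bool} {w : RPrimeInv K}
    (hw : w ∈ Submodule.span (RPrime K) {1}) (h : comp (!t) w = 0) : w ∈ compLattice K t 1 := by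
  obtain ⟨a, rfl⟩ := Submodule.mem_span_singleton.1 hw
  rw [Algebra.smul_def, mul_one] at h ⊢
  obtain ⟨f, g, hfg⟩ := rPrime_exists_eq a
  have hinj := FaithfulSMul.algebraMap_injective K[X] (LaurentSeries K)
  rw [hfg] at h ⊢
  cases t
  · refine ⟨-g, ?_⟩
    change comp true _ = 0 at h
    rw [map_add, map_mul, comp_true_y, comp_algebraMap, comp_algebraMap, ← map_mul, ← map_add,
      map_eq_zero_iff _ hinj] at h
    rw [map_add, map_mul, comp_false_y, mul_zero, add_zero, comp_algebraMap]
    congr 1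
    linear_combination h
  · refine ⟨g, ?_⟩
    change comp false _ = 0 at h
    rw [map_add, map_mul, comp_false_y, mul_zero, add_zero, comp_algebraMap,
      map_eq_zero_iff _ hinj] at h
    rw [map_add, map_mul, comp_true_y, comp_algebraMap, h, map_zero, zero_add, comp_algebraMap,
      ← map_mul]
    congr 1
    ring

theorem mem_compLattice_two_of_comp_eq_zero {t : Bool} {w : RPrimeInv K}
    (hw : w ∈ Submodule.span (RPrime K) {x K}) (h : comp (!t) w = 0) : w ∈ compLattice K t 2 := by
  obtain ⟨a, rfl⟩ := Submodule.mem_span_singleton.1 hw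
  rw [Algebra.smul_def, mul_comm _ (x K)] at h ⊢
  rw [map_mul, comp_x] at h
  refine x_mul_mem_compLattice (mem_compLattice_one_of_comp_eq_zero ?_
    ((mul_eq_zero.1 h).resolve_left algebraMap_laurent_X_ne_zero))
  exact Submodule.mem_span_singleton.2 ⟨a, by rw [Algebra.smul_def, mul_one]⟩

theorem mem_compLattice_innerExp {a : Edge n} {i : Fin n} {t : Bool} {w : RPrimeInv K}
    (hw : w ∈ columnEntry (RPrime K) (x K) (y K) a i) (h : comp (!t) w = 0) :
    w ∈ compLattice K t (innerExp a i) := by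
  have hout := columnEntry_le_compLattice a i t hw
  rcases a with ⟨r, s, hrs⟩ | r | r
  · have hne : (r : ℕ) ≠ s := fun h => hrs (Fin.ext h)
    simp only [columnEntry, outerExp_seg, innerExp_seg, Fin.le_def, Fin.lt_def] at hw hout ⊢
    split_ifs at hw with c1 c2 c3 c2 c3
    · rw [if_pos (by omega)]
      exact mem_compLattice_one_of_comp_eq_zero hw h
    · rw [if_pos c1, if_neg c2] at hout
      rw [if_pos c3]
      exact hout
    · rw [if_neg c3]
      exact mem_compLattice_two_of_comp_eq_zero hw h
    · rw [if_neg c1, if_pos (by omega)] at hout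
      rw [if_pos c2]
      exact hout
    · rw [if_neg c2]
      exact mem_compLattice_two_of_comp_eq_zero hw h
    · rw [if_neg c1, if_neg c3] at hout
      rw [if_neg c2]
      exact hout
  · rwa [outerExp_plain, ← innerExp_plain] at hout
  · rwa [outerExp_notched, ← innerExp_notched] at hout

theorem exists_mem_columnEntry_inner {a : Edge n} {t : Bool} (ha : a.Alive t) (i : Fin n) :
    ∃ w ∈ columnEntry (RPrime K) (x K) (y K) a i,
      comp t w = algebraMap K[X] _ X ^ innerExp a i ∧ comp (!t) w = 0 := by
  have hxy : x K * y K = y K ^ 2 := by rw [pow_two, y_mul_y]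
  have hxxy : x K * (x K - y K) = x K ^ 2 - y K ^ 2 := by
    rw [mul_sub, hxy, pow_two (x K)]
  have key : ∀ k : ℕ, comp t (x K ^ k * compElement K t) = algebraMap K[X] _ X ^ (1 + k) ∧
      comp (!t) (x K ^ k * compElement K t) = 0 := by
    intro k
    rw [map_mul, map_mul, comp_compElement, comp_not_compElement, map_pow, comp_x, mul_zero,
      add_comm, pow_succ]
    exact ⟨rfl, rfl⟩
  suffices h : ∃ k, innerExp a i = 1 + k ∧
      x K ^ k * compElement K t ∈ columnEntry (RPrime K) (x K) (y K) a i by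
    obtain ⟨k, hk, hmem⟩ := h
    exact ⟨_, hmem, by rw [hk, (key k).1], (key k).2⟩
  rcases a with ⟨r, s, hrs⟩ | r | r
  · have hne : (r : ℕ) ≠ s := fun h => hrs (Fin.ext h)
    have hA : ∀ b : RPrimeInv K, b ∈ Set.range (algebraMap (RPrime K) (RPrimeInv K)) →
        b ∈ Submodule.span (RPrime K) {1} := fun b hb => mul_mem_span hb (g := 1) (by simp)
          (mul_one b)
    have hx : x K ∈ Submodule.span (RPrime K) {x K, y K} := Submodule.subset_span (by simp)
    have hy : y K ∈ Submodule.span (RPrime K) {x K, y K} := Submodule.subset_span (by simp)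
    have hA1 : compElement K t ∈ Submodule.span (RPrime K) {1} := by
      cases t
      · exact sub_mem (hA _ ⟨_, rfl⟩) (hA _ ⟨_, rfl⟩)
      · exact hA _ ⟨_, rfl⟩
    have hA2 : compElement K t ∈ Submodule.span (RPrime K) {x K, y K} := by
      cases t
      · exact sub_mem hx hy
      · exact hy
    have hA3 : x K * compElement K t ∈ Submodule.span (RPrime K) {x K} := x_mul_mem_span_x hA1
    have hA4 : x K * compElement K t ∈ Submodule.span (RPrime K) {x K ^ 2, y K ^ 2} :=
      x_mul_mem_span_sq hA2
    refine ⟨_, innerExp_seg r s i hrs, ?_⟩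
    simp only [columnEntry, Fin.le_def, Fin.lt_def]
    split_ifs <;> simp only [pow_zero, one_mul, pow_one] <;> first | assumption | (exfalso; omega)
  · obtain rfl : t = true := ha
    refine ⟨_, innerExp_plain r i, ?_⟩
    change _ * y K ∈ if i ≤ r then _ else _
    split_ifs
    · rw [pow_zero, one_mul]
      exact Submodule.mem_span_singleton_self _
    · rw [pow_one, hxy]
      exact Submodule.mem_span_singleton_self _
  · obtain rfl : t = false := ha
    refine ⟨_, innerExp_notched r i, ?_⟩
    change _ * (x K - y K) ∈ if i ≤ r then _ else _
    split_ifs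
    · rw [pow_zero, one_mul]
      exact Submodule.mem_span_singleton_self _
    · rw [pow_one, hxxy]
      exact Submodule.mem_span_singleton_self _

theorem exists_mem_columnEntry_outer {a : Edge n} {t : Bool} (ha : a.Alive t) (i : Fin n) :
    ∃ w ∈ columnEntry (RPrime K) (x K) (y K) a i,
      comp t w = algebraMap K[X] _ X ^ outerExp a i := by
  rcases a with ⟨r, s, hrs⟩ | r | r
  · have hne : (r : ℕ) ≠ s := fun h => hrs (Fin.ext h)
    refine ⟨x K ^ outerExp (.seg r s hrs) i, ?_, by rw [map_pow, comp_x]⟩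
    have hx : x K ∈ Submodule.span (RPrime K) {x K, y K} := Submodule.subset_span (by simp)
    have hx1 : x K ∈ Submodule.span (RPrime K) {x K} := Submodule.subset_span (by simp)
    have h1 : (1 : RPrimeInv K) ∈ Submodule.span (RPrime K) {1} := Submodule.subset_span (by simp)
    have hx2 : x K ^ 2 ∈ Submodule.span (RPrime K) {x K ^ 2, y K ^ 2} :=
      Submodule.subset_span (by simp)
    simp only [columnEntry, outerExp_seg, Fin.le_def, Fin.lt_def]
    split_ifs <;> simp only [pow_zero, pow_one, zero_add, add_zero, one_add_one_eq_two] <;>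
      first | assumption | (exfalso; omega)
  · obtain ⟨w, hw, hw', -⟩ := exists_mem_columnEntry_inner (K := K) ha i
    exact ⟨w, hw, by rwa [outerExp_plain, ← innerExp_plain]⟩
  · obtain ⟨w, hw, hw', -⟩ := exists_mem_columnEntry_inner (K := K) ha i
    exact ⟨w, hw, by rwa [outerExp_notched, ← innerExp_notched]⟩

theorem comp_eq_zero_of_not_alive {a : Edge n} {t : Bool} (ha : ¬ a.Alive t) {i : Fin n}
    {w : RPrimeInv K} (hw : w ∈ columnEntry (RPrime K) (x K) (y K) a i) : comp t w = 0 := by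
  rcases a with ⟨r, s, hrs⟩ | r | r
  · exact absurd trivial ha
  · obtain rfl : t = false := by simpa [Edge.Alive] using ha
    simp only [columnEntry] at hw
    split_ifs at hw <;> obtain ⟨c, rfl⟩ := Submodule.mem_span_singleton.1 hw
    · rw [Algebra.smul_def, map_mul, comp_false_y, mul_zero]
    · rw [Algebra.smul_def, map_mul, map_pow, comp_false_y, zero_pow two_ne_zero, mul_zero]
  · obtain rfl : t = true := by simpa [Edge.Alive] using ha
    simp only [columnEntry] at hw
    split_ifs at hw <;> obtain ⟨c, rfl⟩ := Submodule.mem_span_singleton.1 hw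
    · rw [Algebra.smul_def, map_mul, map_sub, comp_true_y, comp_x, sub_self, mul_zero]
    · rw [Algebra.smul_def, map_mul, map_sub, map_pow, map_pow, comp_true_y, comp_x, sub_self,
        mul_zero]

end Exponents

/-! ### Homomorphisms between the modules `M_a` -/

section Homomorphisms

variable {K : Type*} [Field K] {n : ℕ}

theorem matrixUnit_smul_apply {i j k : Fin n} {b : RPrimeInv K} (hb) (v : Fin n → RPrimeInv K) :
    (matrixUnit i j b hb • v) k = if k = i then b * v j else 0 := by
  rw [order_smul_apply, Finset.sum_eq_single j]
  · change Matrix.single i j b k j * _ = _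
    rw [Matrix.single_apply]
    simp only [and_true, eq_comm (a := i), ite_mul, zero_mul]
  · intro l _ hl
    change Matrix.single i j b k l * _ = 0
    rw [Matrix.single_apply_of_col_ne _ _ hl.symm, zero_mul]
  · exact fun h => absurd (Finset.mem_univ j) h

theorem scalarHom_smul_apply (a : RPrime K) (v : Fin n → RPrimeInv K) (k : Fin n) :
    (scalarHom K n a • v) k = algebraMap _ _ a * v k := by
  rw [order_smul_apply, Finset.sum_eq_single k]
  · rw [coe_scalarHom, Matrix.algebraMap_matrix_apply, if_pos rfl]
    rfl
  · intro l _ hl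
    rw [coe_scalarHom, Matrix.algebraMap_matrix_apply, if_neg hl.symm, zero_mul]
  · exact fun h => absurd (Finset.mem_univ k) h

theorem single_mem_columnModule {a : Edge n} {i : Fin n} {w : RPrimeInv K}
    (hw : w ∈ columnEntry (RPrime K) (x K) (y K) a i) : Pi.single i w ∈ columnModule K a := by
  intro j
  by_cases h : j = i
  · subst h
    rwa [Pi.single_eq_same]
  · rw [Pi.single_eq_of_ne h]
    exact Submodule.zero_mem _

theorem columnEntry_le_span_one (a : Edge n) (i : Fin n) :
    columnEntry (RPrime K) (x K) (y K) a i ≤ Submodule.span (RPrime K) {1} := by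
  have h : ∀ r : RPrime K, algebraMap (RPrime K) (RPrimeInv K) r ∈
      Submodule.span (RPrime K) {(1 : RPrimeInv K)} := fun r =>
    Submodule.mem_span_singleton.2 ⟨r, by rw [Algebra.smul_def, mul_one]⟩
  have h1 := h 1
  rw [map_one] at h1
  have hx : x K ∈ Submodule.span (RPrime K) {(1 : RPrimeInv K)} := h _
  have hy : y K ∈ Submodule.span (RPrime K) {(1 : RPrimeInv K)} := h _
  have hx2 : x K ^ 2 ∈ Submodule.span (RPrime K) {(1 : RPrimeInv K)} := by
    rw [x, ← map_pow]
    exact h _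
  have hy2 : y K ^ 2 ∈ Submodule.span (RPrime K) {(1 : RPrimeInv K)} := by
    rw [y, ← map_pow]
    exact h _
  rcases a with ⟨r, s, hrs⟩ | r | r <;> simp only [columnEntry] <;> split_ifs <;>
    simp only [Submodule.span_le, Set.insert_subset_iff, Set.singleton_subset_iff, SetLike.mem_coe,
      h1, hx, hy, hx2, hy2, sub_mem hx hy, sub_mem hx2 hy2, and_self]

theorem exists_eq_algebraMap_of_mem_columnEntry {a : Edge n} {i : Fin n} {w : RPrimeInv K}
    (hw : w ∈ columnEntry (RPrime K) (x K) (y K) a i) :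
    ∃ r : RPrime K, w = algebraMap _ _ r := by
  obtain ⟨r, rfl⟩ := Submodule.mem_span_singleton.1 (columnEntry_le_span_one a i hw)
  exact ⟨r, by rw [Algebra.smul_def, mul_one]⟩

theorem baseElement_mul {a : Edge n} {i : Fin n} {w : RPrimeInv K}
    (hw : w ∈ columnEntry (RPrime K) (x K) (y K) a i) : baseElement K a * w = x K * w := by
  have hyy := y_mul_y K
  rcases a with ⟨r, s, hrs⟩ | r | r
  · rfl
  · simp only [columnEntry] at hw
    simp only [baseElement]
    split_ifs at hw <;> obtain ⟨c, rfl⟩ := Submodule.mem_span_singleton.1 hw <;>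
      rw [Algebra.smul_def]
    · linear_combination algebraMap _ _ c * hyy
    · linear_combination algebraMap _ _ c * y K * hyy
  · simp only [columnEntry] at hw
    simp only [baseElement]
    split_ifs at hw <;> obtain ⟨c, rfl⟩ := Submodule.mem_span_singleton.1 hw <;>
      rw [Algebra.smul_def]
    · linear_combination algebraMap _ _ c * hyy
    · linear_combination algebraMap _ _ c * (x K + y K) * hyy

/-- The element of `M_a` whose only nonzero coordinate is the first one, equal to
`baseElement a`. -/
noncomputable def baseVector {o : Fin n} (ho : (o : ℕ) = 0) (a : Edge n) : columnModule K a :=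
  ⟨Pi.single o (baseElement K a), single_mem_columnModule (baseElement_mem_columnEntry a ho)⟩

variable {o : Fin n} (ho : (o : ℕ) = 0) {a b c : Edge n}

/-- The element of `R'[X⁻¹]` by which a homomorphism `M_a → M_b` multiplies. -/
noncomputable def homScalar (f : columnModule K a →ₗ[LambdaOrder K n] columnModule K b) :
    RPrimeInv K :=
  xInv K * (f (baseVector ho a)).1 o

/-- Homomorphisms `M_a → M_b` are multiplications by scalars: the matrix units of `Λ` move every
coordinate to the first one, where `baseElement a` and the coordinate differ by scalars in `R'`. -/
theorem apply_eq_homScalar_mul (f : columnModule K a →ₗ[LambdaOrder K n] columnModule K b)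
    (v : columnModule K a) (i : Fin n) : (f v).1 i = homScalar ho f * v.1 i := by
  obtain ⟨r, hr⟩ := exists_eq_algebraMap_of_mem_columnEntry (v.2 i)
  have hv : scalarHom K n r • baseVector ho a =
      scalarHom K n (algebraMap K[X] _ X) • matrixUnit o i (1 : RPrimeInv K)
        (one_mem_orderEntry_of_le (le_of_val_eq_zero ho i)) • v := by
    refine Subtype.ext (funext fun k => ?_)
    change (scalarHom K n r • (Pi.single o (baseElement K a) : Fin n → RPrimeInv K)) k =
      (scalarHom K n (algebraMap K[X] _ X) • matrixUnit o i (1 : RPrimeInv K)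
        (one_mem_orderEntry_of_le (le_of_val_eq_zero ho i)) • v.1) k
    rw [scalarHom_smul_apply, scalarHom_smul_apply, matrixUnit_smul_apply, one_mul, ← hr]
    by_cases hk : k = o
    · rw [if_pos hk, hk, Pi.single_eq_same, mul_comm, baseElement_mul (v.2 i)]
      rfl
    · rw [if_neg hk, Pi.single_eq_of_ne hk, mul_zero, mul_zero]
  have h := congrArg (fun w : columnModule K b => w.1 o) (congrArg f hv)
  rw [map_smul, map_smul, map_smul] at h
  change (scalarHom K n r • (f (baseVector ho a)).1) o =
    (scalarHom K n (algebraMap K[X] _ X) • matrixUnit o i (1 : RPrimeInv K)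
      (one_mem_orderEntry_of_le (le_of_val_eq_zero ho i)) • (f v).1) o at h
  rw [scalarHom_smul_apply, scalarHom_smul_apply, matrixUnit_smul_apply, one_mul, ← hr,
    if_pos rfl] at h
  change _ = x K * _ at h
  rw [homScalar]
  linear_combination -(f v).1 i * x_mul_xInv K - xInv K * h

theorem homScalar_mul_mem (f : columnModule K a →ₗ[LambdaOrder K n] columnModule K b) {i : Fin n}
    {w : RPrimeInv K} (hw : w ∈ columnEntry (RPrime K) (x K) (y K) a i) :
    homScalar ho f * w ∈ columnEntry (RPrime K) (x K) (y K) b i := by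
  have h := (f ⟨_, single_mem_columnModule hw⟩).2 i
  rw [apply_eq_homScalar_mul ho] at h
  change homScalar ho f * (Pi.single i w : Fin n → RPrimeInv K) i ∈ _ at h
  rwa [Pi.single_eq_same] at h

theorem homScalar_comp (g : columnModule K b →ₗ[LambdaOrder K n] columnModule K c)
    (f : columnModule K a →ₗ[LambdaOrder K n] columnModule K b) :
    homScalar ho (g.comp f) = homScalar ho g * homScalar ho f := by
  rw [homScalar, LinearMap.comp_apply, apply_eq_homScalar_mul ho g, homScalar, homScalar]
  ring

theorem homScalar_add (f g : columnModule K a →ₗ[LambdaOrder K n] columnModule K b) :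
    homScalar ho (f + g) = homScalar ho f + homScalar ho g := by
  rw [homScalar, LinearMap.add_apply, homScalar, homScalar, ← mul_add]
  rfl

/-- A component on which `M_a` is not zero. -/
def Edge.liveComp : Edge n → Bool
  | .seg _ _ _ => false
  | .plain _ => true
  | .notched _ => false

theorem Edge.alive_liveComp (a : Edge n) : a.Alive a.liveComp := by
  cases a
  · trivial
  · rfl
  · rfl

theorem comp_liveComp_baseElement (a : Edge n) :
    comp a.liveComp (baseElement K a) = algebraMap K[X] _ X := by
  rcases a with ⟨r, s, hrs⟩ | r | r
  · exact comp_x false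
  · exact comp_true_y
  · change comp false (x K - y K) = _
    rw [map_sub, comp_x, comp_false_y, sub_zero]

theorem comp_homScalar_id (a : Edge n) :
    comp a.liveComp (homScalar ho (LinearMap.id (M := columnModule K a)
      (R := LambdaOrder K n))) = 1 := by
  have h : homScalar ho (LinearMap.id (M := columnModule K a) (R := LambdaOrder K n)) =
      xInv K * baseElement K a := by
    change xInv K * (Pi.single o (baseElement K a) : Fin n → RPrimeInv K) o = _
    rw [Pi.single_eq_same]
  rw [h, map_mul, comp_liveComp_baseElement, ← comp_x (K := K) a.liveComp, ← map_mul, mul_comm,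
    x_mul_xInv, map_one]

/-- Comparison of the orders of the scalar of a homomorphism with the exponents of source and
target. -/
theorem le_order_comp_homScalar (f : columnModule K a →ₗ[LambdaOrder K n] columnModule K b)
    {t : Bool} (ha : a.Alive t) (h0 : comp t (homScalar ho f) ≠ 0) (i : Fin n) :
    (outerExp b i : ℤ) ≤ (comp t (homScalar ho f)).order + outerExp a i ∧
      (innerExp b i : ℤ) ≤ (comp t (homScalar ho f)).order + innerExp a i := by
  have hT := algebraMap_laurent_X_ne_zero (K := K)
  have key : ∀ (k : ℕ) (w : RPrimeInv K), comp t w = algebraMap K[X] _ X ^ k →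
      comp t (homScalar ho f * w) ≠ 0 ∧
      (comp t (homScalar ho f * w)).order = (comp t (homScalar ho f)).order + k := by
    intro k w hw
    have hk : algebraMap K[X] (LaurentSeries K) X ^ k ≠ 0 := pow_ne_zero _ hT
    rw [map_mul, hw, HahnSeries.order_mul h0 hk, HahnSeries.order_pow, order_algebraMap_X]
    exact ⟨mul_ne_zero h0 hk, by simp⟩
  constructor
  · obtain ⟨w, hw, hwt⟩ := exists_mem_columnEntry_outer (K := K) ha i
    obtain ⟨h1, h2⟩ := key _ w hwt
    rw [← h2]
    exact order_comp_of_mem_compLattice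
      (columnEntry_le_compLattice b i t (homScalar_mul_mem ho f hw)) h1
  · obtain ⟨w, hw, hwt, hwt'⟩ := exists_mem_columnEntry_inner (K := K) ha i
    obtain ⟨h1, h2⟩ := key _ w hwt
    rw [← h2]
    exact order_comp_of_mem_compLattice (mem_compLattice_innerExp (homScalar_mul_mem ho f hw)
      (by rw [map_mul, hwt', mul_zero])) h1

theorem order_comp_homScalar_nonneg (f : columnModule K a →ₗ[LambdaOrder K n] columnModule K a) :
    0 ≤ (comp a.liveComp (homScalar ho f)).order := by
  by_cases h0 : comp a.liveComp (homScalar ho f) = 0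
  · rw [h0, HahnSeries.order_zero]
  · have := (le_order_comp_homScalar ho f a.alive_liveComp h0 o).1
    omega

theorem alive_of_comp_homScalar_ne_zero
    (f : columnModule K a →ₗ[LambdaOrder K n] columnModule K b) {t : Bool} (ha : a.Alive t)
    (h0 : comp t (homScalar ho f) ≠ 0) : b.Alive t := by
  by_contra hb
  obtain ⟨w, hw, hwt⟩ := exists_mem_columnEntry_outer (K := K) ha o
  have h := comp_eq_zero_of_not_alive hb (homScalar_mul_mem ho f hw)
  rw [map_mul, hwt] at h
  exact (mul_ne_zero h0 (pow_ne_zero _ algebraMap_laurent_X_ne_zero)) h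

/-- The residue character of the endomorphism ring of `M_a`: the constant coefficient of the scalar
by which an endomorphism multiplies. -/
noncomputable def residueChar (a : Edge n) :
    Module.End (LambdaOrder K n) (columnModule K a) →+ K where
  toFun f := (comp a.liveComp (homScalar ho f)).coeff 0
  map_zero' := by
    have h : homScalar ho (0 : Module.End (LambdaOrder K n) (columnModule K a)) = 0 :=
      mul_zero (xInv K)
    rw [h, map_zero]
    rfl
  map_add' f g := by rw [homScalar_add, map_add, HahnSeries.coeff_add]

theorem residueChar_apply (f : Module.End (LambdaOrder K n) (columnModule K a)) :
    residueChar ho a f = (comp a.liveComp (homScalar ho f)).coeff 0 :=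
  rfl

theorem residueChar_one (a : Edge n) : residueChar (K := K) ho a 1 = 1 := by
  rw [residueChar_apply]
  refine (congrArg (fun z : LaurentSeries K => z.coeff 0) (comp_homScalar_id ho a)).trans ?_
  rw [HahnSeries.coeff_one, if_pos rfl]

theorem residueChar_mul (f g : Module.End (LambdaOrder K n) (columnModule K a)) :
    residueChar ho a (f * g) = residueChar ho a f * residueChar ho a g := by
  rw [residueChar_apply, Module.End.mul_eq_comp, homScalar_comp, map_mul,
    LaurentSeries.coeff_zero_mul (order_comp_homScalar_nonneg ho f)
      (order_comp_homScalar_nonneg ho g)]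
  rfl

/-- Endomorphisms of `M_b` that factor through `M_a` with `a ≠ b` have residue zero: a nonzero
residue forces the exponents of `M_a` and `M_b` to agree up to a shift. -/
theorem residueChar_comp_of_ne (hab : a ≠ b)
    (f : columnModule K b →ₗ[LambdaOrder K n] columnModule K a)
    (g : columnModule K a →ₗ[LambdaOrder K n] columnModule K b) :
    residueChar ho b (g.comp f) = 0 := by
  by_contra h
  rw [residueChar_apply, homScalar_comp, map_mul] at h
  have hg0 : comp b.liveComp (homScalar ho g) ≠ 0 := fun h0 => h (by rw [h0, zero_mul]; rfl)
  have hf0 : comp b.liveComp (homScalar ho f) ≠ 0 := fun h0 => h (by rw [h0, mul_zero]; rfl)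
  have ha := alive_of_comp_homScalar_ne_zero ho f b.alive_liveComp hf0
  have hle := HahnSeries.order_le_of_coeff_ne_zero h
  rw [HahnSeries.order_mul hg0 hf0] at hle
  have hf := le_order_comp_homScalar ho f b.alive_liveComp hf0
  have hg := le_order_comp_homScalar ho g ha hg0
  have hoa : innerExp a o = 1 := by
    rw [innerExp, if_pos (le_of_val_eq_zero ho _)]
  have hob : innerExp b o = 1 := by
    rw [innerExp, if_pos (le_of_val_eq_zero ho _)]
  have hfo := hf o
  have hgo := hg o
  rw [hoa, hob] at hfo hgo
  refine hab (Edge.eq_of_exp_eq ha b.alive_liveComp (fun i => ?_) fun i => ?_)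
  · have := hf i
    have := hg i
    omega
  · have := hf i
    have := hg i
    omega

/-- An idempotent endomorphism of `M_a` of residue zero vanishes. -/
theorem eq_zero_of_residueChar_eq_zero {f : Module.End (LambdaOrder K n) (columnModule K a)}
    (hf : f * f = f) (h : residueChar ho a f = 0) : f = 0 := by
  have hsq : homScalar ho f * homScalar ho f = homScalar ho f := by
    have := homScalar_comp ho f f
    rw [← Module.End.mul_eq_comp, hf] at this
    exact this.symm
  have hcomp : ∀ t, comp t (homScalar ho f) = 0 ∨ comp t (homScalar ho f) = 1 := by
    intro t
    have h1 := congrArg (comp t) hsq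
    rw [map_mul] at h1
    by_cases h0 : comp t (homScalar ho f) = 0
    · exact Or.inl h0
    · exact Or.inr (mul_left_cancel₀ h0 (h1.trans (mul_one _).symm))
  have hlive : comp a.liveComp (homScalar ho f) = 0 := by
    refine (hcomp _).resolve_right fun h1 => ?_
    rw [residueChar_apply, h1, HahnSeries.coeff_one, if_pos rfl] at h
    exact one_ne_zero h
  -- In the other component the scalar is `0` or `1`. It is not `1`: in the coordinates at the
  -- source, the projection of `M_a` to that component is strictly larger than the intersection with it.
  have hdead : ∀ {i} {w}, w ∈ columnEntry (RPrime K) (x K) (y K) a i →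
      comp (!a.liveComp) (homScalar ho f * w) = 0 := by
    intro i w hw
    by_cases ha : a.Alive (!a.liveComp)
    · rw [map_mul, (hcomp _).resolve_right, zero_mul]
      intro h1
      obtain ⟨z, hz, hzt⟩ := exists_mem_columnEntry_outer (K := K) ha a.source
      have hmem := mem_compLattice_innerExp (t := !a.liveComp) (homScalar_mul_mem ho f hz)
        (by rw [Bool.not_not, map_mul, hlive, zero_mul])
      have hne : comp (!a.liveComp) (homScalar ho f * z) ≠ 0 := by
        rw [map_mul, h1, one_mul, hzt]
        exact pow_ne_zero _ algebraMap_laurent_X_ne_zero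
      have hle := order_comp_of_mem_compLattice hmem hne
      rw [map_mul, h1, one_mul, hzt, HahnSeries.order_pow, order_algebraMap_X] at hle
      have hlt : outerExp a a.source < innerExp a a.source := by
        rcases a with ⟨r, s, hrs⟩ | r | r
        · have hne : (r : ℕ) ≠ s := fun h => hrs (Fin.ext h)
          simp only [outerExp_seg, innerExp_seg, Edge.source, Fin.le_def, Fin.lt_def]
          split_ifs <;> omega
        · exact absurd ha (by simp [Edge.Alive, Edge.liveComp])
        · exact absurd ha (by simp [Edge.Alive, Edge.liveComp])
      simp only [nsmul_eq_mul, mul_one] at hle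
      omega
    · exact comp_eq_zero_of_not_alive ha (homScalar_mul_mem ho f hw)
  refine LinearMap.ext fun v => Subtype.ext (funext fun i => ?_)
  rw [apply_eq_homScalar_mul ho]
  exact eq_zero_of_forall_comp_eq_zero (by rw [map_mul, hlive, zero_mul]) (hdead (v.2 i))

end Homomorphisms

end PuncturedPolygon

/-! ### Multiplicities and indecomposability from characters -/

section Multiplicities

variable {Λ E k : Type*} [Ring Λ] [Field k] {M : E → Type*}
  [∀ a, AddCommGroup (M a)] [∀ a, Module Λ (M a)]

/-- The inclusion of the `j`-th copy of `M a`. -/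
def multiplicityIncl [DecidableEq E] (l : E → ℕ) (a : E) (j : Fin (l a)) :
    M a →ₗ[Λ] (b : E) → Fin (l b) → M b :=
  (LinearMap.single Λ (fun b => Fin (l b) → M b) a).comp (LinearMap.single Λ (fun _ => M a) j)

/-- The projection to the `j`-th copy of `M a`. -/
def multiplicityProj (l : E → ℕ) (a : E) (j : Fin (l a)) :
    ((b : E) → Fin (l b) → M b) →ₗ[Λ] M a :=
  (LinearMap.proj (R := Λ) (φ := fun _ : Fin (l a) => M a) j).comp
    (LinearMap.proj (R := Λ) (φ := fun b => Fin (l b) → M b) a)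

theorem sum_multiplicityIncl_comp_proj [DecidableEq E] [Fintype E] (l : E → ℕ) :
    ∑ a, ∑ j, (multiplicityIncl l a j).comp (multiplicityProj l a j) =
      LinearMap.id (R := Λ) (M := (b : E) → Fin (l b) → M b) := by
  refine LinearMap.ext fun v => ?_
  simp only [LinearMap.sum_apply, LinearMap.comp_apply, LinearMap.id_apply, multiplicityIncl,
    ← map_sum]
  change ∑ a, Pi.single a (∑ j, Pi.single j (v a j)) = v
  rw [← Finset.univ_sum_single v]
  refine Finset.sum_congr rfl fun a _ => ?_
  rw [Finset.univ_sum_single, Finset.univ_sum_single]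

theorem multiplicityProj_comp_incl [DecidableEq E] (l : E → ℕ) (a : E) (i j : Fin (l a)) :
    (multiplicityProj l a i).comp (multiplicityIncl l a j) =
      if i = j then (1 : Module.End Λ (M a)) else 0 := by
  refine LinearMap.ext fun v => ?_
  change (Pi.single a (Pi.single j v : Fin (l a) → M a) : (b : E) → Fin (l b) → M b) a i = _
  rw [Pi.single_eq_same]
  split_ifs with h
  · rw [h, Pi.single_eq_same]
    rfl
  · rw [Pi.single_eq_of_ne h]
    rfl

/-- If `M b` has a multiplicative character with values in a field that kills the endomorphisms
factoring through the other members of the family, then the multiplicity of `M b` in a direct sum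
is at most its multiplicity in any other sum containing the first as a direct summand: the
characters of the matrix entries of the two maps form scalar matrices with product the identity. -/
theorem multiplicity_le_of_leftInverse [Fintype E] (b : E) (χ : Module.End Λ (M b) →+ k)
    (hone : χ 1 = 1) (hmul : ∀ f g, χ (f * g) = χ f * χ g)
    (hne : ∀ a, a ≠ b → ∀ (f : M b →ₗ[Λ] M a) (g : M a →ₗ[Λ] M b), χ (g.comp f) = 0)
    {l l' : E → ℕ} (Φ : ((a : E) → Fin (l a) → M a) →ₗ[Λ] ((a : E) → Fin (l' a) → M a))
    (Ψ : ((a : E) → Fin (l' a) → M a) →ₗ[Λ] ((a : E) → Fin (l a) → M a))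
    (h : Ψ.comp Φ = LinearMap.id) : l b ≤ l' b := by
  classical
  let F : Matrix (Fin (l' b)) (Fin (l b)) k :=
    fun i j => χ (((multiplicityProj l' b i).comp Φ).comp (multiplicityIncl l b j))
  let G : Matrix (Fin (l b)) (Fin (l' b)) k :=
    fun i j => χ (((multiplicityProj l b i).comp Ψ).comp (multiplicityIncl l' b j))
  have hGF : G * F = 1 := by
    ext i j
    have key : (multiplicityProj l b i).comp (multiplicityIncl l b j) =
        ∑ a, ∑ t, (((multiplicityProj l b i).comp Ψ).comp (multiplicityIncl l' a t)).comp
          (((multiplicityProj l' a t).comp Φ).comp (multiplicityIncl l b j)) := by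
      refine LinearMap.ext fun v => ?_
      have h1 := LinearMap.congr_fun (sum_multiplicityIncl_comp_proj (Λ := Λ) (M := M) l')
        (Φ (multiplicityIncl (Λ := Λ) l b j v))
      have h2 := LinearMap.congr_fun h (multiplicityIncl (Λ := Λ) l b j v)
      rw [LinearMap.id_apply] at h1 h2
      rw [LinearMap.comp_apply, ← h2, LinearMap.comp_apply, ← h1]
      simp only [LinearMap.sum_apply, LinearMap.comp_apply, map_sum]
    have hχ := congrArg χ key
    rw [multiplicityProj_comp_incl, map_sum, Finset.sum_eq_single b, map_sum] at hχ
    · rw [Matrix.mul_apply, Matrix.one_apply]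
      refine (Finset.sum_congr rfl fun t _ => ?_).trans (hχ.symm.trans ?_)
      · exact (hmul _ _).symm
      · split_ifs
        · exact hone
        · exact map_zero χ
    · intro a _ hab
      rw [map_sum]
      exact Finset.sum_eq_zero fun t _ => hne a hab _ _
    · exact fun h => absurd (Finset.mem_univ b) h
  calc l b = (1 : Matrix (Fin (l b)) (Fin (l b)) k).rank := by
        rw [Matrix.rank_one, Fintype.card_fin]
    _ = (G * F).rank := by rw [hGF]
    _ ≤ F.rank := Matrix.rank_mul_le_right G F
    _ ≤ Fintype.card (Fin (l' b)) := Matrix.rank_le_card_height F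
    _ = l' b := Fintype.card_fin _

/-- A finite product of members of a family, regrouped by isotypic blocks. -/
theorem exists_linearEquiv_directSum [Fintype E] {m : ℕ} (a : Fin m → E) :
    ∃ l : E → ℕ, Nonempty (((k : Fin m) → M (a k)) ≃ₗ[Λ]
      DirectSum E fun b => Fin (l b) → M b) := by
  classical
  let e : ((k : Fin m) → M (a k)) ≃ₗ[Λ] ((b : E) → {k : Fin m // a k = b} → M b) :=
    { toFun := fun f b i => i.2 ▸ f i.1
      map_add' := fun f g => by
        funext b ⟨i, hi⟩
        subst hi
        rfl
      map_smul' := fun c f => by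
        funext b ⟨i, hi⟩
        subst hi
        rfl
      invFun := fun g k => g (a k) ⟨k, rfl⟩
      left_inv := fun f => rfl
      right_inv := fun g => by
        funext b ⟨i, hi⟩
        subst hi
        rfl }
  refine ⟨fun b => Fintype.card {k : Fin m // a k = b}, ⟨(e.trans
    (LinearEquiv.piCongrRight fun b =>
      LinearEquiv.funCongrLeft Λ (M b) (Fintype.equivFin {k : Fin m // a k = b}).symm)).trans
    (DirectSum.linearEquivFunOnFintype Λ E _).symm⟩⟩

end Multiplicities

/-- A nonzero module is indecomposable if its endomorphism ring has a multiplicative character with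
values in a field that vanishes at no idempotent other than zero. -/
theorem isIndecomposableModule_of_character {Λ M k : Type*} [Ring Λ] [Field k] [AddCommGroup M]
    [Module Λ M] [Nontrivial M] (χ : Module.End Λ M →+ k) (hone : χ 1 = 1)
    (hmul : ∀ f g, χ (f * g) = χ f * χ g) (hzero : ∀ f, f * f = f → χ f = 0 → f = 0) :
    IsIndecomposableModule Λ M := by
  refine ⟨inferInstance, fun N N' h => ?_⟩
  let p : Module.End Λ M := N.projection N' h
  have hp : IsIdempotentElem p := Submodule.isIdempotentElem_projection h
  have hχ : IsIdempotentElem (χ p) := (hmul p p).symm.trans (congrArg χ hp)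
  rcases IsIdempotentElem.iff_eq_zero_or_one.1 hχ with h0 | h1
  · left
    exact (Submodule.range_projection h).symm.trans
      ((congrArg LinearMap.range (hzero p hp h0)).trans LinearMap.range_zero)
  · right
    have hq := hzero (1 - p) hp.one_sub (by rw [map_sub, hone, h1, sub_self])
    exact (Submodule.ker_projection h).symm.trans
      ((congrArg LinearMap.ker (sub_eq_zero.1 hq).symm).trans LinearMap.ker_id)

/-- An indecomposable module that is a finite product of nonzero modules is one of the factors. -/
theorem IsIndecomposableModule.exists_linearEquiv {Λ M : Type*} [Ring Λ] [AddCommGroup M]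
    [Module Λ M] (hM : IsIndecomposableModule Λ M) {m : ℕ} {P : Fin m → Type*}
    [∀ k, AddCommGroup (P k)] [∀ k, Module Λ (P k)] [∀ k, Nontrivial (P k)]
    (e : M ≃ₗ[Λ] (k : Fin m) → P k) : ∃ k, Nonempty (M ≃ₗ[Λ] P k) := by
  obtain ⟨hnt, hM⟩ := hM
  obtain _ | m := m
  · exact absurd e.toEquiv.subsingleton (not_subsingleton M)
  let i : P 0 →ₗ[Λ] M := e.symm.toLinearMap.comp (LinearMap.single Λ P 0)
  let p : M →ₗ[Λ] P 0 := (LinearMap.proj 0).comp e.toLinearMap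
  have hpi : ∀ v, p (i v) = v := fun v => by
    change e (e.symm (Pi.single 0 v)) 0 = v
    rw [e.apply_symm_apply, Pi.single_eq_same]
  have hid : IsIdempotentElem (i.comp p : Module.End Λ M) :=
    LinearMap.ext fun v => congrArg i (hpi (p v))
  rcases hM _ _ (LinearMap.IsIdempotentElem.isCompl hid) with h | h
  · obtain ⟨v, hv⟩ := exists_ne (0 : P 0)
    have hi : i v = 0 := (Submodule.mem_bot Λ).1 (h ▸ ⟨i v, congrArg i (hpi v)⟩)
    exact absurd ((hpi v).symm.trans (by rw [hi, map_zero])) hv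
  · refine ⟨0, ⟨LinearEquiv.ofBijective p ⟨(injective_iff_map_eq_zero p).2 fun w hw => ?_,
      fun v => ⟨i v, hpi v⟩⟩⟩⟩
    exact (Submodule.mem_bot Λ).1 (h ▸ LinearMap.mem_ker.2 (by
      rw [LinearMap.comp_apply, hw, map_zero]))

namespace PuncturedPolygon

/-! ### The modules `M_a` are Cohen-Macaulay, indecomposable and pairwise non-isomorphic -/

variable {K : Type*} [Field K] {n : ℕ}

instance : Finite (Edge n) :=
  Finite.of_injective (β := (Fin n × Fin n) ⊕ Fin n ⊕ Fin n)
    (fun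
      | .seg r s _ => .inl (r, s)
      | .plain r => .inr (.inl r)
      | .notched r => .inr (.inr r))
    fun a b h => by cases a <;> cases b <;> simp_all

theorem isCMModule_columnModule (a : Edge n) :
    IsCMModule K[X] (LambdaOrder K n) (columnModule K a) := by
  constructor
  · let N : Submodule K[X] (RPrimeInv K) := Submodule.span K[X] {1, y K}
    have hN : ∀ v : columnModule K a, ∀ i, v.1 i ∈ N := fun v i => by
      obtain ⟨r, hr⟩ := exists_eq_algebraMap_of_mem_columnEntry (v.2 i)
      obtain ⟨f, g, hfg⟩ := rPrime_exists_eq r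
      refine Submodule.mem_span_pair.2 ⟨f, g, ?_⟩
      rw [hr, hfg, Algebra.smul_def, Algebra.smul_def, mul_one]
    have : Module.Finite K[X] N := Module.Finite.span_of_finite K[X] (Set.toFinite _)
    let φ : columnModule K a →ₗ[K[X]] Fin n → N :=
      { toFun := fun v i => ⟨v.1 i, hN v i⟩
        map_add' := fun _ _ => rfl
        map_smul' := fun _ _ => rfl }
    exact Module.Finite.of_injective φ fun v w h =>
      Subtype.ext (funext fun i => congrArg Subtype.val (congrFun h i))
  · have : Module.IsTorsionFree K[X] (columnModule K a) := by
      refine Module.IsTorsionFree.of_smul_eq_zero (R := K[X]) (M := columnModule K a)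
        fun p v h => ?_
      have h' : p • v.1 = 0 := congrArg Subtype.val h
      exact (smul_eq_zero.1 h').imp_right fun h => Subtype.ext h
    exact moduleSocle_eq_bot_iff_isTorsionFree.2 this

section

variable {o : Fin n} (ho : (o : ℕ) = 0)

include ho

theorem nontrivial_columnModule (a : Edge n) : Nontrivial (columnModule K a) :=
  nontrivial_of_ne (baseVector ho a) 0 fun h => baseElement_ne_zero (K := K) a <| by
    have := congrFun (congrArg Subtype.val h) o
    change (Pi.single o (baseElement K a) : Fin n → RPrimeInv K) o = 0 at this
    rwa [Pi.single_eq_same] at this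

theorem isIndecomposableModule_columnModule (a : Edge n) :
    IsIndecomposableModule (LambdaOrder K n) (columnModule K a) := by
  have := nontrivial_columnModule (K := K) ho a
  exact isIndecomposableModule_of_character (M := columnModule K a) (residueChar ho a)
    (residueChar_one ho a) (residueChar_mul ho) fun _ => eq_zero_of_residueChar_eq_zero ho

theorem eq_of_linearEquiv {a b : Edge n}
    (e : columnModule K a ≃ₗ[LambdaOrder K n] columnModule K b) : a = b := by
  by_contra hab
  have h := residueChar_comp_of_ne ho hab e.symm.toLinearMap e.toLinearMap
  have he : e.toLinearMap.comp e.symm.toLinearMap = (1 : Module.End _ _) :=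
    LinearMap.ext fun v => e.apply_symm_apply v
  rw [he, residueChar_one] at h
  exact one_ne_zero h

/-- The multiplicities of the modules `M_a` in a direct sum are uniquely determined. -/
theorem eq_of_directSum_linearEquiv {l l' : Edge n → ℕ}
    (e : (DirectSum (Edge n) fun a => Fin (l a) → columnModule K a) ≃ₗ[LambdaOrder K n]
      DirectSum (Edge n) fun a => Fin (l' a) → columnModule K a) : l = l' := by
  classical
  have := Fintype.ofFinite (Edge n)
  have hle : ∀ {l l' : Edge n → ℕ}, ((DirectSum (Edge n) fun a => Fin (l a) → columnModule K a)
      ≃ₗ[LambdaOrder K n] DirectSum (Edge n) fun a => Fin (l' a) → columnModule K a) →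
      ∀ b, l b ≤ l' b := fun {l l'} e b => by
    let e' := ((DirectSum.linearEquivFunOnFintype (LambdaOrder K n) (Edge n)
      fun a => Fin (l a) → columnModule K a).symm.trans e).trans
      (DirectSum.linearEquivFunOnFintype (LambdaOrder K n) (Edge n)
        fun a => Fin (l' a) → columnModule K a)
    exact multiplicity_le_of_leftInverse (Λ := LambdaOrder K n)
      (M := fun a : Edge n => columnModule K a) b (residueChar ho b) (residueChar_one ho b)
      (residueChar_mul ho) (fun a hab => residueChar_comp_of_ne ho hab) e'.toLinearMap
      e'.symm.toLinearMap (LinearMap.ext fun v => e'.symm_apply_apply v)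
  exact funext fun b => (hle e b).antisymm (hle e.symm b)

end

end PuncturedPolygon

theorem mainTheorem3 {K : Type u} [Field K] {n : ℕ} (hn : 2 ≤ n) :
    -- the map `a ↦ M_a` from sides and tagged arcs to indecomposable Cohen-Macaulay modules is
    -- well defined, injective up to isomorphism, and surjective up to isomorphism
    ((∀ a : PuncturedPolygon.Edge n,
        IsCMModule (Polynomial K) (PuncturedPolygon.LambdaOrder K n)
            (PuncturedPolygon.columnModule K a) ∧
          IsIndecomposableModule (PuncturedPolygon.LambdaOrder K n)
            (PuncturedPolygon.columnModule K a)) ∧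
      (∀ a b : PuncturedPolygon.Edge n,
        Nonempty (PuncturedPolygon.columnModule K a ≃ₗ[PuncturedPolygon.LambdaOrder K n]
          PuncturedPolygon.columnModule K b) → a = b) ∧
      (∀ (M : Type v) [AddCommGroup M] [Module (Polynomial K) M]
        [Module (PuncturedPolygon.LambdaOrder K n) M]
        [IsScalarTower (Polynomial K) (PuncturedPolygon.LambdaOrder K n) M],
        IsCMModule (Polynomial K) (PuncturedPolygon.LambdaOrder K n) M →
        IsIndecomposableModule (PuncturedPolygon.LambdaOrder K n) M →
        ∃ a : PuncturedPolygon.Edge n,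
          Nonempty (M ≃ₗ[PuncturedPolygon.LambdaOrder K n] PuncturedPolygon.columnModule K a))) ∧
    -- every Cohen-Macaulay module decomposes, with uniquely determined multiplicities
    (∀ (M : Type v) [AddCommGroup M] [Module (Polynomial K) M]
      [Module (PuncturedPolygon.LambdaOrder K n) M]
      [IsScalarTower (Polynomial K) (PuncturedPolygon.LambdaOrder K n) M],
      IsCMModule (Polynomial K) (PuncturedPolygon.LambdaOrder K n) M →
      ∃! l : PuncturedPolygon.Edge n → ℕ,
        Nonempty (M ≃ₗ[PuncturedPolygon.LambdaOrder K n]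
          DirectSum (PuncturedPolygon.Edge n)
            fun a => Fin (l a) → PuncturedPolygon.columnModule K a)) := by
  have ho : ((⟨0, by omega⟩ : Fin n) : ℕ) = 0 := rfl
  refine ⟨⟨fun a => ⟨PuncturedPolygon.isCMModule_columnModule a,
    PuncturedPolygon.isIndecomposableModule_columnModule ho a⟩,
    fun a b ⟨e⟩ => PuncturedPolygon.eq_of_linearEquiv ho e, ?_⟩, ?_⟩
  · intro M _ _ _ _ hCM hM
    obtain ⟨m, a, ⟨e⟩⟩ := PuncturedPolygon.exists_linearEquiv_pi_columnModule hn M hCM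
    have := fun k => PuncturedPolygon.nontrivial_columnModule (K := K) ho (a k)
    obtain ⟨k, hk⟩ := hM.exists_linearEquiv
      (P := fun k => PuncturedPolygon.columnModule K (a k)) e
    exact ⟨a k, hk⟩
  · intro M _ _ _ _ hCM
    obtain ⟨m, a, ⟨e⟩⟩ := PuncturedPolygon.exists_linearEquiv_pi_columnModule hn M hCM
    have := Fintype.ofFinite (PuncturedPolygon.Edge n)
    obtain ⟨l, ⟨e'⟩⟩ := exists_linearEquiv_directSum (Λ := PuncturedPolygon.LambdaOrder K n)
      (M := fun a : PuncturedPolygon.Edge n => PuncturedPolygon.columnModule K a) a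
    exact ⟨l, ⟨e.trans e'⟩, fun l' ⟨e''⟩ =>
      PuncturedPolygon.eq_of_directSum_linearEquiv ho (e''.symm.trans (e.trans e'))⟩
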